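/- Let $k$ be an algebraically closed field of characteristic zero. For $n\ge 1$ let $\mathcal A_s(n)$ be the Hopf algebra over $k$ presented as an algebra by generators $u_{ij}$, $1\le i,j\le n$, with relations $$u_{ij}u_{il}=\delta_{jl}u_{ij},\qquad u_{ij}u_{lj}=\delta_{il}u_{ij},\qquad \sum_{l=1}^n u_{il}=1=\sum_{l=1}^n u_{li}\qquad(1\le i,j,l\le n),$$ with comultiplication, counit and antipode determined by $\Delta(u_{ij})=\sum_{l}u_{il}\otimes u_{lj}$, $\varepsilon(u_{ij})=\delta_{ij}$, $S(u_{ij})=u_{ji}$. A Hopf algebra $H$ over $k$ is called a quantum permutation algebra if it is a quotient Hopf algebra of $\mathcal A_s(n)$ for some $n\ge 1$, i.e. if there is a surjective Hopf algebra map $\mathcal A_s(n)\to H$. A left (respectively right) coideal subalgebra of $H$ is a unital subalgebra $L\subseteq H$ with $\Delta(L)\subseteq H\otimes L$ (respectively $\Delta(L)\subseteq L\otimes H$). Its matrix coefficients are the elements $(\mathrm{id}\otimes f)(\Delta(x))$ (respectively $(f\otimes\mathrm{id})(\Delta(x))$) of $H$, with $x\in L$ and $f\in L^*=\mathrm{Hom}_k(L,k)$.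 Theorem. Let $H$ be a finite-dimensional cosemisimple Hopf algebra over $k$ (that is, as a coalgebra $H$ is a direct sum of simple subcoalgebras). Then $H$ is a quantum permutation algebra if and only if $H$ is generated as an algebra by the matrix coefficients of its commutative left coideal subalgebras. Likewise, $H$ is a quantum permutation algebra if and only if $H$ is generated as an algebra by the matrix coefficients of its commutative right coideal subalgebras. -/

import Mathlib

open scoped TensorProduct

universe u v

noncomputable section

namespace QuantumPermutation

/-- A square matrix `x` over a ring `B` is *magic* if in each row and in each column the entries are
pairwise orthogonal idempotents with sum `1`. -/
structure IsMagic {B : Type*} [Semiring B] {n : ℕ} (x : Fin n → Fin n → B) : Prop where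
  row_mul : ∀ i j k, x i j * x i k = if j = k then x i j else 0
  col_mul : ∀ i j k, x i j * x k j = if i = k then x i j else 0
  row_sum : ∀ i, ∑ l, x i l = 1
  col_sum : ∀ i, ∑ l, x l i = 1

/-! ### Wang's algebra, presented by the entries of a magic matrix -/

section Wang

variable (k : Type u) [Field k] (n : ℕ)

/-- The free generator with indices `i`, `j`. -/
abbrev gen (i j : Fin n) : FreeAlgebra k (Fin n × Fin n) := FreeAlgebra.ι k (i, j)

/-- The defining relations of Wang's algebra: the matrix of generators is magic. -/
inductive Rel : FreeAlgebra k (Fin n × Fin n) → FreeAlgebra k (Fin n × Fin n) → Prop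
  | row_mul (i j l : Fin n) :
      Rel (gen k n i j * gen k n i l) (if j = l then gen k n i j else 0)
  | col_mul (i j l : Fin n) :
      Rel (gen k n i j * gen k n l j) (if i = l then gen k n i j else 0)
  | row_sum (i : Fin n) : Rel (∑ l, gen k n i l) 1
  | col_sum (i : Fin n) : Rel (∑ l, gen k n l i) 1

/-- The algebra `A_s(n)` of functions on the quantum permutation group of `n` points: the `k`-algebra
with generators `u i j`, `i, j : Fin n`, and relations making `u` a magic matrix. -/
def As : Type u := RingQuot (Rel k n)

instance : Ring (As k n) := inferInstanceAs (Ring (RingQuot (Rel k n)))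

instance instAlgebraAs : Algebra k (As k n) := inferInstanceAs (Algebra k (RingQuot (Rel k n)))

/-- The projection from the free algebra. -/
def mkAs : FreeAlgebra k (Fin n × Fin n) →ₐ[k] As k n := RingQuot.mkAlgHom k (Rel k n)

variable {k n}

/-- The generators of `A_s(n)`. -/
def u (i j : Fin n) : As k n := mkAs k n (gen k n i j)

theorem isMagic_u : IsMagic (u : Fin n → Fin n → As k n) where
  row_mul i j l := by
    have h : mkAs k n _ = mkAs k n _ := RingQuot.mkAlgHom_rel k (Rel.row_mul (k := k) i j l)
    rw [map_mul] at h
    rw [u, u, h]; split_ifs <;> simp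
  col_mul i j l := by
    have h : mkAs k n _ = mkAs k n _ := RingQuot.mkAlgHom_rel k (Rel.col_mul (k := k) i j l)
    rw [map_mul] at h
    rw [u, u, h]; split_ifs <;> simp
  row_sum i := by
    have h : mkAs k n _ = mkAs k n _ := RingQuot.mkAlgHom_rel k (Rel.row_sum (k := k) i)
    rwa [map_sum, map_one] at h
  col_sum i := by
    have h : mkAs k n _ = mkAs k n _ := RingQuot.mkAlgHom_rel k (Rel.col_sum (k := k) i)
    rwa [map_sum, map_one] at h

/-- The universal property of `A_s(n)`: a magic matrix over an algebra `B` defines an algebra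
homomorphism from `A_s(n)` to `B`. -/
def liftAs {B : Type*} [Ring B] [Algebra k B] (x : Fin n → Fin n → B) (hx : IsMagic x) :
    As k n →ₐ[k] B :=
  RingQuot.liftAlgHom k (s := Rel k n) ⟨FreeAlgebra.lift k fun p => x p.1 p.2, by
    intro a b h
    cases h with
    | row_mul i j l =>
      have := hx.row_mul i j l
      split_ifs at this ⊢ <;> simpa using this
    | col_mul i j l =>
      have := hx.col_mul i j l
      split_ifs at this ⊢ <;> simpa using this
    | row_sum i => simpa using hx.row_sum i
    | col_sum i => simpa using hx.col_sum i⟩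

@[simp]
theorem liftAs_u {B : Type*} [Ring B] [Algebra k B] (x : Fin n → Fin n → B) (hx : IsMagic x)
    (i j : Fin n) : liftAs (k := k) x hx (u i j) = x i j := by
  have h : liftAs (k := k) x hx (mkAs k n (gen k n i j)) =
      FreeAlgebra.lift k (fun p : Fin n × Fin n => x p.1 p.2) (gen k n i j) :=
    RingQuot.liftAlgHom_mkAlgHom_apply k _ _ _
  rw [u, h]
  simp

theorem algHom_ext_As {B : Type*} [Semiring B] [Algebra k B] {f g : As k n →ₐ[k] B}
    (h : ∀ i j, f (u i j) = g (u i j)) : f = g :=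
  RingQuot.ringQuot_ext' k f g (FreeAlgebra.hom_ext (funext fun p => h p.1 p.2))

theorem induction_As {P : As k n → Prop} (hs : ∀ r : k, P (algebraMap k _ r))
    (hu : ∀ i j, P (u i j)) (hm : ∀ a b, P a → P b → P (a * b))
    (ha : ∀ a b, P a → P b → P (a + b)) (a : As k n) : P a := by
  obtain ⟨y, rfl⟩ := (RingQuot.mkAlgHom_surjective k (Rel k n) : Function.Surjective (mkAs k n)) a
  induction y with
  | grade0 r => rw [AlgHom.commutes]; exact hs r
  | grade1 p => exact hu p.1 p.2
  | mul a b h1 h2 => rw [map_mul]; exact hm _ _ h1 h2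
  | add a b h1 h2 => rw [map_add]; exact ha _ _ h1 h2

theorem isMagic_comul :
    IsMagic (fun i j : Fin n => ∑ l, (u i l : As k n) ⊗ₜ[k] (u l j : As k n)) where
  row_mul i j l := by
    simp only [Finset.sum_mul_sum, Algebra.TensorProduct.tmul_mul_tmul, isMagic_u.row_mul,
      TensorProduct.ite_tmul, Finset.sum_ite_eq, Finset.mem_univ, if_true]
    split_ifs <;> simp
  col_mul i j l := by
    simp only [Finset.sum_mul_sum, Algebra.TensorProduct.tmul_mul_tmul, isMagic_u.col_mul,
      TensorProduct.tmul_ite, Finset.sum_ite_eq, Finset.mem_univ, if_true]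
    split_ifs with h
    · subst h; simp
    · simp
  row_sum i := by
    rw [Finset.sum_comm]
    simp [← TensorProduct.tmul_sum, ← TensorProduct.sum_tmul, isMagic_u.row_sum,
      Algebra.TensorProduct.one_def]
  col_sum i := by
    rw [Finset.sum_comm]
    simp [← TensorProduct.tmul_sum, ← TensorProduct.sum_tmul, isMagic_u.col_sum,
      Algebra.TensorProduct.one_def]

theorem isMagic_counit : IsMagic (fun i j : Fin n => if i = j then (1 : k) else 0) where
  row_mul i j l := by split_ifs <;> simp_all
  col_mul i j l := by split_ifs <;> simp_all
  row_sum i := by simp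
  col_sum i := by simp

theorem isMagic_antipode :
    IsMagic (fun i j : Fin n => MulOpposite.op (u j i : As k n)) where
  row_mul i j l := by
    rw [← MulOpposite.op_mul, isMagic_u.col_mul]
    split_ifs <;> simp_all
  col_mul i j l := by
    rw [← MulOpposite.op_mul, isMagic_u.row_mul]
    split_ifs <;> simp_all
  row_sum i := by rw [← Finset.op_sum, isMagic_u.col_sum, MulOpposite.op_one]
  col_sum i := by rw [← Finset.op_sum, isMagic_u.row_sum, MulOpposite.op_one]

/-- The comultiplication, `u i j ↦ ∑ l, u i l ⊗ u l j`. -/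
def comulAs : As k n →ₐ[k] As k n ⊗[k] As k n := liftAs _ isMagic_comul

/-- The counit, `u i j ↦ δ i j`. -/
def counitAs : As k n →ₐ[k] k := liftAs _ isMagic_counit

/-- The antipode: the antimultiplicative map with `u i j ↦ u j i`. -/
def antipodeAs : As k n →ₗ[k] As k n :=
  (MulOpposite.opLinearEquiv k).symm.toLinearMap ∘ₗ
    (liftAs (k := k) _ (isMagic_antipode (k := k) (n := n))).toLinearMap

theorem comulAs_u (i j : Fin n) :
    comulAs (u i j : As k n) = ∑ l, (u i l : As k n) ⊗ₜ[k] (u l j : As k n) := by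
  simp [comulAs]

theorem counitAs_u (i j : Fin n) : counitAs (u i j : As k n) = if i = j then 1 else 0 := by
  simp [counitAs]

theorem antipodeAs_u (i j : Fin n) : antipodeAs (u i j : As k n) = u j i := by
  simp [antipodeAs]

theorem antipodeAs_one : antipodeAs (1 : As k n) = 1 := by
  simp [antipodeAs]

theorem antipodeAs_mul (a b : As k n) :
    antipodeAs (a * b) = antipodeAs b * antipodeAs a := by
  simp [antipodeAs]

instance instBialgebraAs : Bialgebra k (As k n) :=
  Bialgebra.ofAlgHom comulAs counitAs
    (algHom_ext_As fun i j => by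
      simp [comulAs_u, TensorProduct.sum_tmul, TensorProduct.tmul_sum]
      rw [Finset.sum_comm])
    (algHom_ext_As fun i j => by
      simp [comulAs_u, counitAs_u, TensorProduct.ite_tmul])
    (algHom_ext_As fun i j => by
      simp [comulAs_u, counitAs_u, TensorProduct.tmul_ite])

theorem comul_eq (a : As k n) : Coalgebra.comul (R := k) a = comulAs a := rfl

theorem counit_eq (a : As k n) : Coalgebra.counit (R := k) a = counitAs a := rfl

theorem antipode_left (a : As k n) :
    LinearMap.mul' k (As k n) (antipodeAs.rTensor (As k n) (comulAs a)) =
      algebraMap k _ (counitAs a) := by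
  induction a using induction_As with
  | hs r =>
    simp [Algebra.algebraMap_eq_smul_one, Algebra.TensorProduct.one_def, antipodeAs_one]
  | hu i j =>
    simp only [comulAs_u, map_sum, LinearMap.rTensor_tmul, LinearMap.mul'_apply, antipodeAs_u,
      isMagic_u.row_mul, counitAs_u]
    split_ifs with h
    · simp [isMagic_u.col_sum]
    · simp
  | hm a b h1 h2 =>
    have key : ∀ (x y : As k n) (t : As k n ⊗[k] As k n),
        LinearMap.mul' k (As k n) (antipodeAs.rTensor (As k n) (t * x ⊗ₜ y)) =
        antipodeAs x * LinearMap.mul' k (As k n) (antipodeAs.rTensor (As k n) t) * y := by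
      intro x y t
      induction t with
      | zero => simp
      | tmul p q => simp [antipodeAs_mul, mul_assoc]
      | add p q hp hq => simp [add_mul, mul_add, hp, hq]
    have key2 : ∀ s : As k n ⊗[k] As k n,
        LinearMap.mul' k (As k n) (antipodeAs.rTensor (As k n) (comulAs a * s)) =
        counitAs a • LinearMap.mul' k (As k n) (antipodeAs.rTensor (As k n) s) := by
      intro s
      induction s with
      | zero => simp
      | tmul p q => rw [key, h1]; simp [Algebra.algebraMap_eq_smul_one]
      | add p q hp hq => simp [mul_add, hp, hq]
    rw [map_mul, key2, h2, map_mul, map_mul, Algebra.smul_def]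
  | ha a b h1 h2 => simp [h1, h2]

theorem antipode_right (a : As k n) :
    LinearMap.mul' k (As k n) (antipodeAs.lTensor (As k n) (comulAs a)) =
      algebraMap k _ (counitAs a) := by
  induction a using induction_As with
  | hs r =>
    simp [Algebra.algebraMap_eq_smul_one, Algebra.TensorProduct.one_def, antipodeAs_one]
  | hu i j =>
    simp only [comulAs_u, map_sum, LinearMap.lTensor_tmul, LinearMap.mul'_apply, antipodeAs_u,
      isMagic_u.col_mul, counitAs_u]
    split_ifs with h
    · simp [isMagic_u.row_sum]
    · simp
  | hm a b h1 h2 =>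
    have key : ∀ (x y : As k n) (t : As k n ⊗[k] As k n),
        LinearMap.mul' k (As k n) (antipodeAs.lTensor (As k n) (x ⊗ₜ y * t)) =
        x * LinearMap.mul' k (As k n) (antipodeAs.lTensor (As k n) t) * antipodeAs y := by
      intro x y t
      induction t with
      | zero => simp
      | tmul p q => simp [antipodeAs_mul, mul_assoc]
      | add p q hp hq => simp [add_mul, mul_add, hp, hq]
    have key2 : ∀ s : As k n ⊗[k] As k n,
        LinearMap.mul' k (As k n) (antipodeAs.lTensor (As k n) (s * comulAs b)) =
        counitAs b • LinearMap.mul' k (As k n) (antipodeAs.lTensor (As k n) s) := by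
      intro s
      induction s with
      | zero => simp
      | tmul p q => rw [key, h2]; simp [Algebra.algebraMap_eq_smul_one]
      | add p q hp hq => simp [add_mul, hp, hq]
    rw [map_mul, key2, h1, map_mul, map_mul, Algebra.smul_def, Algebra.commutes]
  | ha a b h1 h2 => simp [h1, h2]

/-- The Hopf algebra structure of `A_s(n)`. -/
instance instHopfAlgebraAs : HopfAlgebra k (As k n) where
  antipode := antipodeAs
  mul_antipode_rTensor_comul := LinearMap.ext antipode_left
  mul_antipode_lTensor_comul := LinearMap.ext antipode_right

end Wang

/-! ### Quantum permutation algebras, cosemisimplicity, coideal subalgebras -/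

section Hopf

variable (k : Type u) [Field k] (H : Type v) [Ring H] [HopfAlgebra k H]

/-- A Hopf algebra `H` is a *quantum permutation algebra* if it is a quotient Hopf algebra of
`A_s(n)` for some `n ≥ 1`. (A bialgebra map of Hopf algebras commutes with the antipodes.) -/
def IsQuantumPermutationAlgebra : Prop :=
  ∃ n : ℕ, 1 ≤ n ∧ ∃ f : As k n →ₐc[k] H, Function.Surjective f

section Coalgebra

variable {k} {C : Type v} [AddCommGroup C] [Module k C] [Coalgebra k C]

/-- A subcoalgebra: a subspace `D` with `Δ(D) ⊆ D ⊗ D`. -/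
def IsSubcoalgebra (D : Submodule k C) : Prop :=
  ∀ d ∈ D, Coalgebra.comul (R := k) d ∈ LinearMap.range (TensorProduct.map D.subtype D.subtype)

/-- A simple subcoalgebra: a nonzero subcoalgebra without proper nonzero subcoalgebras. -/
structure IsSimpleSubcoalgebra (D : Submodule k C) : Prop where
  isSubcoalgebra : IsSubcoalgebra D
  ne_bot : D ≠ ⊥
  eq_bot_or_eq : ∀ E : Submodule k C, IsSubcoalgebra E → E ≤ D → E = ⊥ ∨ E = D

end Coalgebra

/-- A coalgebra is *cosemisimple* if it is a direct sum of simple subcoalgebras. -/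
def IsCosemisimple (C : Type v) [AddCommGroup C] [Module k C] [Coalgebra k C] : Prop :=
  ∃ S : Set (Submodule k C), (∀ D ∈ S, IsSimpleSubcoalgebra D) ∧ sSupIndep S ∧ sSup S = ⊤

variable {k H}

/-- A left coideal: a subspace `L` of `H` with `Δ(L) ⊆ H ⊗ L`. -/
def IsLeftCoideal (L : Submodule k H) : Prop :=
  ∀ x ∈ L, Coalgebra.comul (R := k) x ∈ LinearMap.range (L.subtype.lTensor H)

/-- A right coideal: a subspace `L` of `H` with `Δ(L) ⊆ L ⊗ H`. -/
def IsRightCoideal (L : Submodule k H) : Prop :=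
  ∀ x ∈ L, Coalgebra.comul (R := k) x ∈ LinearMap.range (L.subtype.rTensor H)

/-- The matrix coefficients `(id ⊗ f)(Δ(x))`, `x ∈ L`, `f ∈ L*`, of a left coideal `L`, considered as
a left `H`-comodule. Here `t ∈ H ⊗ L` is `Δ(x)`. -/
def leftCoefficients (L : Submodule k H) : Set H :=
  {h | ∃ x ∈ L, ∃ t : H ⊗[k] L, L.subtype.lTensor H t = Coalgebra.comul (R := k) x ∧
    ∃ f : Module.Dual k L, h = TensorProduct.rid k H (f.lTensor H t)}

/-- The matrix coefficients `(f ⊗ id)(Δ(x))`, `x ∈ L`, `f ∈ L*`, of a right coideal `L`, considered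
as a right `H`-comodule. Here `t ∈ L ⊗ H` is `Δ(x)`. -/
def rightCoefficients (L : Submodule k H) : Set H :=
  {h | ∃ x ∈ L, ∃ t : L ⊗[k] H, L.subtype.rTensor H t = Coalgebra.comul (R := k) x ∧
    ∃ f : Module.Dual k L, h = TensorProduct.lid k H (f.rTensor H t)}

variable (k H)

/-- `H` is generated as an algebra by the matrix coefficients of its commutative left coideal
subalgebras. -/
def IsGeneratedByLeft : Prop :=
  Algebra.adjoin k {h : H | ∃ L : Subalgebra k H, IsLeftCoideal (Subalgebra.toSubmodule L) ∧
    (∀ x ∈ L, ∀ y ∈ L, x * y = y * x) ∧ h ∈ leftCoefficients (Subalgebra.toSubmodule L)} = ⊤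

/-- `H` is generated as an algebra by the matrix coefficients of its commutative right coideal
subalgebras. -/
def IsGeneratedByRight : Prop :=
  Algebra.adjoin k {h : H | ∃ L : Subalgebra k H, IsRightCoideal (Subalgebra.toSubmodule L) ∧
    (∀ x ∈ L, ∀ y ∈ L, x * y = y * x) ∧ h ∈ rightCoefficients (Subalgebra.toSubmodule L)} = ⊤

end Hopf

end QuantumPermutation

end

/-! A surjection `As k n → H` is the same as a magic matrix with entries generating `H` on which `Δ`
and `ε` act as on matrix coefficients (`IsMagicCorep`). The theorem thus links such matrices with
commutative coideal subalgebras.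

From matrices to coideals: each column of a magic corepresentation spans a commutative left coideal
subalgebra and each row a right one. A functional picking out a nonzero entry of that column or row
recovers the entries of the matrix as coefficients.

From coideals to matrices, let `R` be a commutative left coideal subalgebra. Cosemisimplicity gives
a normalized invariant functional `h` (`exists_isHaar`). The form `h(ab)` on `R` is nondegenerate:
its radical is an ideal and a left coideal, and Nakayama's lemma excludes a nonzero one
(`radical_eq_bot_of_isLeftCoidealMap`). Its Casimir element is coinvariant, hence a scalar, so the
trace of `R` is `(dim R) h` (`trace_eq_finrank_mul_haar`). In characteristic zero `R` is therefore
reduced, so `R` is a product of copies of `k`. In the basis of minimal idempotents the Gram matrix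
is scalar, which makes the coaction matrix orthogonal; together with multiplicativity of `Δ` this
makes it magic (`exists_isMagicCorep_of_isLeftCoidealMap`). Block sums of magic matrices are magic,
so by finite dimension one matrix collects all coefficients (`exists_isMagicCorep_entries_largest`).

Right coideals are carried to left ones by the antipode `S`, which is bijective. For this reason
coideals appear as injective maps `φ : M → H`: the inclusion of `L`, the identity of `H` and `S`
restricted to `L` are all covered. -/

namespace QuantumPermutation

open Coalgebra

/-! ### The Haar functional of a cosemisimple Hopf algebra. -/

section HaarFunctional

variable {k : Type*} [Field k] {H : Type*} [Ring H] [HopfAlgebra k H]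

/-- A normalized left invariant functional, `(id ⊗ h) Δ = h(·) 1`. -/
structure IsHaar (h : Module.Dual k H) : Prop where
  map_one : h 1 = 1
  invariant : ∀ a : H, TensorProduct.rid k H (h.lTensor H (comul (R := k) a)) = algebraMap k H (h a)

theorem nontrivial_of_hopfAlgebra (k H : Type*) [Field k] [Ring H] [HopfAlgebra k H] :
    Nontrivial H :=
  (Bialgebra.counitAlgHom k H).toRingHom.domain_nontrivial

theorem isSubcoalgebra_sSup {C : Type*} [AddCommGroup C] [Module k C] [Coalgebra k C]
    {S : Set (Submodule k C)} (hS : ∀ D ∈ S, IsSubcoalgebra D) : IsSubcoalgebra (sSup S) := by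
  have key : sSup S ≤ (LinearMap.range (TensorProduct.map (sSup S).subtype (sSup S).subtype)).comap
      (comul (R := k)) := by
    refine sSup_le fun D hD d hd => ?_
    have hle : D ≤ sSup S := le_sSup hD
    obtain ⟨t, ht⟩ := hS D hD d hd
    refine ⟨TensorProduct.map (Submodule.inclusion hle) (Submodule.inclusion hle) t, ?_⟩
    rw [← ht, ← LinearMap.comp_apply, ← TensorProduct.map_comp]
    rfl
  exact fun d hd => key hd

/-- Since `Δ(D) ⊆ D ⊗ D`, it is enough that one of the two legs is killed. -/
theorem map_comul_eq_zero {C : Type*} [AddCommGroup C] [Module k C] [Coalgebra k C]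
    {D : Submodule k C} (hD : IsSubcoalgebra D) {V W : Type*} [AddCommGroup V] [Module k V]
    [AddCommGroup W] [Module k W] (f : C →ₗ[k] V) (g : C →ₗ[k] W)
    (hfg : (∀ d ∈ D, f d = 0) ∨ ∀ d ∈ D, g d = 0) {d : C} (hd : d ∈ D) :
    TensorProduct.map f g (comul (R := k) d) = 0 := by
  obtain ⟨t, ht⟩ := hD d hd
  rw [← ht, ← LinearMap.comp_apply, ← TensorProduct.map_comp]
  rcases hfg with h | h
  · have : f ∘ₗ D.subtype = 0 := LinearMap.ext fun x => h x x.2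
    simp [this]
  · have : g ∘ₗ D.subtype = 0 := LinearMap.ext fun x => h x x.2
    simp [this]

theorem isCompl_sSup_diff {S : Set (Submodule k H)} (hi : sSupIndep S) (ht : sSup S = ⊤)
    {D : Submodule k H} (hD : D ∈ S) : IsCompl D (sSup (S \ {D})) := by
  refine ⟨hi hD, ?_⟩
  rw [codisjoint_iff, eq_top_iff, ← ht]
  refine sSup_le fun E hE => ?_
  by_cases h : E = D
  · exact h ▸ le_sup_left
  · exact le_sup_of_le_right (le_sSup ⟨hE, h⟩)

/-- With `p`, `q` the two projections, `p ⊗ q` kills `Δ(D)` and `Δ(M)`, hence `Δ(1) = 1 ⊗ 1`; but it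
sends `1 ⊗ 1` to `d ⊗ m`. -/
theorem eq_zero_or_eq_zero_of_add_eq_one {D M : Submodule k H} (hD : IsSubcoalgebra D)
    (hM : IsSubcoalgebra M) (hc : IsCompl D M) {d m : H} (hd : d ∈ D) (hm : m ∈ M)
    (h1 : d + m = 1) : d = 0 ∨ m = 0 := by
  set p := D.projection M hc
  set q := M.projection D hc.symm
  have hpd : p d = d := Submodule.projection_apply_of_mem_left hc hd
  have hpM : ∀ x ∈ M, p x = 0 := fun x hx => (Submodule.projection_apply_eq_zero_iff hc).2 hx
  have hqD : ∀ x ∈ D, q x = 0 := fun x hx => (Submodule.projection_apply_eq_zero_iff hc.symm).2 hx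
  have hqm : q m = m := Submodule.projection_apply_of_mem_left hc.symm hm
  have h : TensorProduct.map p q (comul (R := k) (1 : H)) = 0 := by
    rw [← h1, map_add, map_add, map_comul_eq_zero hD p q (.inr hqD) hd,
      map_comul_eq_zero hM p q (.inl hpM) hm, add_zero]
  rw [Bialgebra.comul_one, Algebra.TensorProduct.one_def, TensorProduct.map_tmul, ← h1, map_add,
    map_add, hpd, hpM m hm, hqD d hd, hqm, add_zero, zero_add] at h
  by_contra! hne
  refine hne.2 ?_
  obtain ⟨f, hf⟩ : ∃ f : Module.Dual k H, f d ≠ 0 := by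
    by_contra! hf
    exact hne.1 ((Module.forall_dual_apply_eq_zero_iff k d).1 hf)
  have := congrArg (fun t => TensorProduct.lid k H (f.rTensor H t)) h
  simpa [hf] using this

/-- The unit lies in a finite sum of members of `S`. Splitting off one member at a time, the unit
lies either in that member or in the sum of the others. -/
theorem exists_one_mem_of_isCosemisimple {S : Set (Submodule k H)}
    (hS : ∀ D ∈ S, IsSubcoalgebra D) (hi : sSupIndep S) (ht : sSup S = ⊤) :
    ∃ D ∈ S, (1 : H) ∈ D := by
  classical
  have := nontrivial_of_hopfAlgebra k H
  obtain ⟨s, hs, h1⟩ := Submodule.mem_sSup_iff_exists_finset.1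
    (show (1 : H) ∈ sSup S by rw [ht]; trivial)
  induction s using Finset.induction_on with
  | empty => simp at h1
  | insert D s hDs ih =>
    rw [Finset.iSup_insert] at h1
    obtain ⟨d, hd, m, hm, hdm⟩ := Submodule.mem_sup.1 h1
    have hDS : D ∈ S := hs (by simp)
    have hsS : ∀ E ∈ s, E ∈ S := fun E hE => hs (by simp [hE])
    have hm' : m ∈ sSup (S \ {D}) := by
      refine (iSup₂_le fun E hE => le_sSup ⟨hsS E hE, ?_⟩ : ⨆ i ∈ s, i ≤ sSup (S \ {D})) hm
      rintro rfl
      exact hDs hE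
    rcases eq_zero_or_eq_zero_of_add_eq_one (hS D hDS)
      (isSubcoalgebra_sSup fun E hE => hS E hE.1) (isCompl_sSup_diff hi ht hDS) hd hm' hdm with h | h
    · refine ih hsS ?_
      rwa [← hdm, h, zero_add]
    · refine ⟨D, hDS, ?_⟩
      rwa [← hdm, h, add_zero]

theorem isSubcoalgebra_span_one : IsSubcoalgebra (k ∙ (1 : H)) := by
  intro d hd
  obtain ⟨c, rfl⟩ := Submodule.mem_span_singleton.1 hd
  have h1 : (1 : H) ∈ k ∙ (1 : H) := Submodule.mem_span_singleton_self 1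
  exact ⟨c • (⟨1, h1⟩ ⊗ₜ ⟨1, h1⟩), by simp [Algebra.TensorProduct.one_def]⟩

theorem exists_isHaar (hH : IsCosemisimple k H) : ∃ h : Module.Dual k H, IsHaar h := by
  obtain ⟨S, hS, hi, ht⟩ := hH
  have := nontrivial_of_hopfAlgebra k H
  obtain ⟨D, hD, h1⟩ := exists_one_mem_of_isCosemisimple (fun D hD => (hS D hD).isSubcoalgebra) hi ht
  -- The line `k1` is a nonzero subcoalgebra of the simple `D`. The functional `h` is the counit on
  -- this line and zero on the sum of the other simple subcoalgebras.
  have hspan : (k ∙ (1 : H)) = D :=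
    ((hS D hD).eq_bot_or_eq _ isSubcoalgebra_span_one
      ((Submodule.span_singleton_le_iff_mem _ _).2 h1)).resolve_left (by simp)
  have hc := isCompl_sSup_diff hi ht hD
  have hM : IsSubcoalgebra (sSup (S \ {D})) :=
    isSubcoalgebra_sSup fun E hE => (hS E hE.1).isSubcoalgebra
  set M := sSup (S \ {D})
  let h : Module.Dual k H := counit (R := k) ∘ₗ D.projection M hc
  have hone : h 1 = 1 := by
    simp [h, Submodule.projection_apply_of_mem_left hc h1]
  have hzero : ∀ m ∈ M, h m = 0 := fun m hm => by
    simp [h, (Submodule.projection_apply_eq_zero_iff hc).2 hm]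
  refine ⟨h, hone, fun a => ?_⟩
  obtain ⟨d, hd, m, hm, rfl⟩ := Submodule.mem_sup.1
    (show a ∈ D ⊔ M by rw [hc.sup_eq_top]; trivial)
  rw [← hspan] at hd
  obtain ⟨c, rfl⟩ := Submodule.mem_span_singleton.1 hd
  have hm0 : h.lTensor H (comul (R := k) m) = 0 := map_comul_eq_zero hM _ _ (.inr hzero) hm
  rw [map_add, map_add, map_add, hm0]
  simp [hone, hzero m hm, Algebra.TensorProduct.one_def, Algebra.algebraMap_eq_smul_one]

end HaarFunctional

/-! ### Coaction matrices of left coideals. -/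

section Corepresentation

variable {k : Type*} [Field k] {ι : Type*} [Fintype ι]

theorem sum_tmul_right_injective {M V : Type*} [AddCommGroup M] [Module k M] [AddCommGroup V]
    [Module k V] {v : ι → V} (hv : LinearIndependent k v) {y z : ι → M}
    (h : ∑ l, y l ⊗ₜ[k] v l = ∑ l, z l ⊗ₜ[k] v l) : y = z := by
  classical
  have hker : LinearMap.ker (Fintype.linearCombination k v) = ⊥ :=
    LinearMap.ker_eq_bot.2 hv.fintypeLinearCombination_injective
  obtain ⟨g, hg⟩ := LinearMap.exists_leftInverse_of_injective _ hker
  have hgv : ∀ j, g (v j) = Pi.single j 1 := fun j => by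
    simpa [Fintype.linearCombination_apply_single] using LinearMap.congr_fun hg (Pi.single j 1)
  ext j
  have := congrArg (fun t => TensorProduct.rid k M ((LinearMap.proj j ∘ₗ g).lTensor M t)) h
  simpa [hgv, Pi.single_apply] using this

variable {H : Type*} [Ring H] [HopfAlgebra k H]

/-- The matrix coefficients of a finite-dimensional left comodule in a basis. -/
structure IsCorep [DecidableEq ι] (x : Matrix ι ι H) : Prop where
  comul_eq : ∀ i j, comul (R := k) (x i j) = ∑ l, x i l ⊗ₜ[k] x l j
  counit_eq : ∀ i j, counit (R := k) (x i j) = if i = j then 1 else 0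

theorem IsCorep.antipode_mul [DecidableEq ι] {x : Matrix ι ι H} (hx : IsCorep (k := k) x) :
    x.map (HopfAlgebra.antipode k) * x = 1 := by
  ext i j
  have := HopfAlgebra.mul_antipode_rTensor_comul_apply (R := k) (x i j)
  rw [hx.comul_eq, hx.counit_eq] at this
  simp only [map_sum, LinearMap.rTensor_tmul, LinearMap.mul'_apply] at this
  rw [Matrix.mul_apply, Matrix.one_apply]
  simp only [Matrix.map_apply]
  rw [this]
  split_ifs <;> simp

theorem IsCorep.mul_antipode [DecidableEq ι] {x : Matrix ι ι H} (hx : IsCorep (k := k) x) :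
    x * x.map (HopfAlgebra.antipode k) = 1 := by
  ext i j
  have := HopfAlgebra.mul_antipode_lTensor_comul_apply (R := k) (x i j)
  rw [hx.comul_eq, hx.counit_eq] at this
  simp only [map_sum, LinearMap.lTensor_tmul, LinearMap.mul'_apply] at this
  rw [Matrix.mul_apply, Matrix.one_apply]
  simp only [Matrix.map_apply]
  rw [this]
  split_ifs <;> simp

/-- An embedding of a vector space in `H` with image a left coideal. -/
def IsLeftCoidealMap {M : Type*} [AddCommGroup M] [Module k M] (φ : M →ₗ[k] H) : Prop :=
  ∀ m, comul (R := k) (φ m) ∈ LinearMap.range (φ.lTensor H)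

variable {M : Type*} [AddCommGroup M] [Module k M] {φ : M →ₗ[k] H}

/-- `x` is the matrix of the coaction on `M` in the basis `b`. -/
def IsCoactionMatrix (φ : M →ₗ[k] H) (b : Module.Basis ι k M) (x : Matrix ι ι H) : Prop :=
  ∀ i, comul (R := k) (φ (b i)) = ∑ l, x i l ⊗ₜ[k] φ (b l)

theorem exists_sum_tmul_basis (b : Module.Basis ι k M) {V : Type*} [AddCommGroup V] [Module k V]
    (t : V ⊗[k] M) : ∃ y : ι → V, t = ∑ l, y l ⊗ₜ[k] b l := by
  obtain ⟨c, rfl⟩ := TensorProduct.eq_repr_basis_right b t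
  exact ⟨c, Finsupp.sum_fintype _ _ (by simp)⟩

theorem IsLeftCoidealMap.exists_isCoactionMatrix (hφ : IsLeftCoidealMap φ)
    (b : Module.Basis ι k M) : ∃ x : Matrix ι ι H, IsCoactionMatrix φ b x := by
  have h : ∀ i, ∃ y : ι → H, comul (R := k) (φ (b i)) = ∑ l, y l ⊗ₜ[k] φ (b l) := fun i => by
    obtain ⟨t, ht⟩ := hφ (b i)
    obtain ⟨y, rfl⟩ := exists_sum_tmul_basis b t
    exact ⟨y, by simp [← ht]⟩
  choose x hx using h
  exact ⟨x, hx⟩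

theorem linearIndependent_comp_basis {ι : Type*} (hinj : Function.Injective φ) (b : Module.Basis ι k M) :
    LinearIndependent k fun i => φ (b i) :=
  b.linearIndependent.map' φ (LinearMap.ker_eq_bot.2 hinj)

/-- Coassociativity and the counit axiom at `φ (b i)`, with coefficients compared at the independent
vectors `φ (b l)`. -/
theorem IsCoactionMatrix.isCorep [DecidableEq ι] {b : Module.Basis ι k M} {x : Matrix ι ι H}
    (hx : IsCoactionMatrix φ b x) (hinj : Function.Injective φ) : IsCorep (k := k) x where
  comul_eq i j := by
    refine congrFun (sum_tmul_right_injective (linearIndependent_comp_basis hinj b)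
      (y := fun j => comul (R := k) (x i j)) (z := fun j => ∑ l, x i l ⊗ₜ[k] x l j) ?_) j
    have h := Coalgebra.coassoc_symm_apply (R := k) (φ (b i))
    rw [hx i] at h
    simp only [map_sum, LinearMap.lTensor_tmul, LinearMap.rTensor_tmul, hx _,
      TensorProduct.tmul_sum, TensorProduct.assoc_symm_tmul] at h
    rw [← h, Finset.sum_comm]
    simp [TensorProduct.sum_tmul]
  counit_eq i j := by
    refine congrFun (sum_tmul_right_injective (M := k) (linearIndependent_comp_basis hinj b)
      (y := fun j => counit (R := k) (x i j)) (z := fun j => if i = j then 1 else 0) ?_) j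
    have h := Coalgebra.rTensor_counit_comul (R := k) (φ (b i))
    rw [hx i] at h
    simpa [TensorProduct.ite_tmul] using h

/-- Every matrix coefficient is a linear combination of the entries of the coaction matrix. -/
theorem IsCoactionMatrix.coefficient_mem {b : Module.Basis ι k M} {x : Matrix ι ι H}
    (hx : IsCoactionMatrix φ b x) (hinj : Function.Injective φ) {A : Submodule k H}
    (hA : ∀ i j, x i j ∈ A) {m : M} {t : H ⊗[k] M}
    (ht : φ.lTensor H t = comul (R := k) (φ m)) (f : Module.Dual k M) :
    TensorProduct.rid k H (f.lTensor H t) ∈ A := by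
  obtain ⟨y, rfl⟩ := exists_sum_tmul_basis b t
  have hy : y = fun l => ∑ i, b.repr m i • x i l := by
    refine sum_tmul_right_injective (linearIndependent_comp_basis hinj b) ?_
    have hm : φ m = ∑ i, b.repr m i • φ (b i) := by
      simpa only [map_sum, map_smul] using congrArg φ (b.sum_repr m).symm
    rw [hm] at ht
    simp only [map_sum, LinearMap.lTensor_tmul, map_smul, hx _] at ht
    rw [ht]
    simp only [Finset.smul_sum, TensorProduct.sum_tmul, TensorProduct.smul_tmul']
    rw [Finset.sum_comm]
  simp only [map_sum, LinearMap.lTensor_tmul, TensorProduct.rid_tmul, hy]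
  exact A.sum_mem fun l _ => A.smul_mem _ (A.sum_mem fun i _ => A.smul_mem _ (hA i l))

end Corepresentation

/-! ### The form `h(ab)` and its radical. -/

section Gram

variable {k : Type*} [Field k] {ι : Type*} [Fintype ι] {H : Type*} [Ring H]
  [HopfAlgebra k H] {M : Type*} [AddCommGroup M] [Module k M]

/-- The Gram matrix of the bilinear form `h(ab)`. -/
noncomputable def gram (h : Module.Dual k H) (φ : M →ₗ[k] H) (b : Module.Basis ι k M) : Matrix ι ι k :=
  Matrix.of fun i j => h (φ (b i) * φ (b j))

variable {h : Module.Dual k H} {φ : M →ₗ[k] H} {b : Module.Basis ι k M} {x : Matrix ι ι H}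

/-- Invariance of `h` at the product `φ (b i) * φ (b j)`. -/
theorem IsCoactionMatrix.mul_gram_mul_transpose (hx : IsCoactionMatrix φ b x) (hh : IsHaar h) :
    x * (gram h φ b).map (algebraMap k H) * x.transpose = (gram h φ b).map (algebraMap k H) := by
  ext i j
  have := hh.invariant (φ (b i) * φ (b j))
  rw [Bialgebra.comul_mul, hx i, hx j] at this
  simp only [Finset.sum_mul_sum, Algebra.TensorProduct.tmul_mul_tmul, map_sum,
    LinearMap.lTensor_tmul, TensorProduct.rid_tmul] at this
  simp only [Matrix.mul_apply, Matrix.map_apply, Matrix.transpose_apply, gram, Matrix.of_apply,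
    Finset.sum_mul]
  rw [← this, Finset.sum_comm]
  refine Finset.sum_congr rfl fun l _ => Finset.sum_congr rfl fun m _ => ?_
  rw [← Algebra.commutes, mul_assoc, ← Algebra.smul_def]

theorem IsCoactionMatrix.gram_mul_transpose [DecidableEq ι] (hx : IsCoactionMatrix φ b x) (hh : IsHaar h)
    (hinj : Function.Injective φ) :
    (gram h φ b).map (algebraMap k H) * x.transpose =
      x.map (HopfAlgebra.antipode k) * (gram h φ b).map (algebraMap k H) := by
  conv_rhs => rw [← hx.mul_gram_mul_transpose hh]
  rw [mul_assoc x, ← mul_assoc, (hx.isCorep hinj).antipode_mul, one_mul]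

/-- The right radical of the form `h(ab)` on `M`. -/
def radical (h : Module.Dual k H) (φ : M →ₗ[k] H) : Submodule k M where
  carrier := {w | ∀ a, h (φ a * φ w) = 0}
  zero_mem' := by simp
  add_mem' := fun hv hw a => by simp [mul_add, hv a, hw a]
  smul_mem' := fun c w hw a => by simp [hw a]

/-- The radical is a left coideal. -/
theorem IsCoactionMatrix.exists_comul_radical [DecidableEq ι] (hx : IsCoactionMatrix φ b x) (hh : IsHaar h)
    (hinj : Function.Injective φ) {κ : Type*} [Fintype κ] (u : Module.Basis κ k H) {w : M}
    (hw : w ∈ radical h φ) :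
    ∃ n : κ → M, (∀ r, n r ∈ radical h φ) ∧ comul (R := k) (φ w) = ∑ r, u r ⊗ₜ[k] φ (n r) := by
  set y : ι → H := fun l => ∑ j, b.repr w j • x j l with hy
  have hφw : φ w = ∑ j, b.repr w j • φ (b j) := by
    simpa only [map_sum, map_smul] using congrArg φ (b.sum_repr w).symm
  have hcomul : comul (R := k) (φ w) = ∑ l, y l ⊗ₜ[k] φ (b l) := by
    rw [hφw]
    simp only [map_sum, map_smul, hx _, hy, Finset.smul_sum, TensorProduct.sum_tmul,
      TensorProduct.smul_tmul']
    rw [Finset.sum_comm]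
  -- If `G` is the Gram matrix and `c` the coordinate vector of `w`, then `y = xᵗ c` and `G xᵗ c =
  -- S(x) G c = 0`.
  have hker : ∀ i, ∑ l, gram h φ b i l • y l = 0 := fun i => by
    have h1 : ∑ l, gram h φ b i l • y l =
        ∑ j, b.repr w j • ((gram h φ b).map (algebraMap k H) * x.transpose) i j := by
      simp only [hy, Matrix.mul_apply, Finset.smul_sum, Matrix.map_apply, Matrix.transpose_apply]
      rw [Finset.sum_comm]
      refine Finset.sum_congr rfl fun l _ => Finset.sum_congr rfl fun m _ => ?_
      rw [← Algebra.smul_def, smul_comm]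
    have h2 : ∀ l, ∑ j, b.repr w j * gram h φ b l j = 0 := fun l => by
      have := hw (b l)
      rw [hφw] at this
      simpa [gram, Finset.mul_sum] using this
    rw [h1, hx.gram_mul_transpose hh hinj]
    simp only [Matrix.mul_apply, Finset.smul_sum, Matrix.map_apply]
    rw [Finset.sum_comm]
    refine Finset.sum_eq_zero fun l _ => ?_
    have : ∀ j, b.repr w j • (HopfAlgebra.antipode k (x i l) * algebraMap k H (gram h φ b l j)) =
        (b.repr w j * gram h φ b l j) • HopfAlgebra.antipode k (x i l) := fun j => by
      rw [← Algebra.commutes, ← Algebra.smul_def, smul_smul]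
    simp only [this, ← Finset.sum_smul, h2, zero_smul]
  -- Since `G` has scalar entries, `G y = 0` holds in each `u`-coordinate of `y` separately; each
  -- coordinate vector gives an element of the radical.
  refine ⟨fun r => ∑ l, u.repr (y l) r • b l, fun r => ?_, ?_⟩
  · have hb : ∀ i, h (φ (b i) * φ (∑ l, u.repr (y l) r • b l)) = 0 := fun i => by
      have := congrArg (fun z => u.repr z r) (hker i)
      simp only [map_sum, map_smul, Finset.mul_sum, Algebra.mul_smul_comm] at this ⊢
      simpa [gram, mul_comm] using this
    have hlin : (h ∘ₗ LinearMap.mulRight k (φ (∑ l, u.repr (y l) r • b l)) ∘ₗ φ) = 0 :=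
      b.ext fun i => hb i
    exact fun a => LinearMap.congr_fun hlin a
  · rw [hcomul]
    conv_lhs => enter [2, l]; rw [← u.sum_repr (y l)]
    simp only [map_sum, map_smul, TensorProduct.sum_tmul, TensorProduct.tmul_sum,
      TensorProduct.tmul_smul, TensorProduct.smul_tmul']
    rw [Finset.sum_comm]

/-- A criterion for nondegeneracy of the form `h(ab)`. -/
theorem IsCoactionMatrix.radical_eq_bot [DecidableEq ι] [Module.Finite k H]
    (hx : IsCoactionMatrix φ b x)
    (hh : IsHaar h) (hinj : Function.Injective φ)
    (h1 : (1 : H) ∈ (⊤ : Submodule k H) * (radical h φ).map φ → (1 : H) ∈ (radical h φ).map φ) :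
    radical h φ = ⊥ := by
  let u := Module.finBasis k H
  -- Otherwise `ε(w) 1 = ∑ S(w₁) w₂` puts `1` in `H · N`, `N` being the image of the radical. By
  -- `h1` then `1 ∈ N`, against `h(1) = 1`.
  have hcounit : ∀ w ∈ radical h φ, counit (R := k) (φ w) = 0 := fun w hw => by
    by_contra hne
    obtain ⟨n, hn, hcomul⟩ := hx.exists_comul_radical hh hinj u hw
    have hS := HopfAlgebra.mul_antipode_rTensor_comul_apply (R := k) (φ w)
    rw [hcomul] at hS
    simp only [map_sum, LinearMap.rTensor_tmul, LinearMap.mul'_apply] at hS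
    have hmem : algebraMap k H (counit (R := k) (φ w)) ∈
        (⊤ : Submodule k H) * (radical h φ).map φ := by
      rw [← hS]
      exact Submodule.sum_mem _ fun r _ =>
        Submodule.mul_mem_mul trivial (Submodule.mem_map_of_mem (hn r))
    rw [Algebra.algebraMap_eq_smul_one, Submodule.smul_mem_iff _ hne] at hmem
    obtain ⟨n, hn, hn1⟩ := h1 hmem
    have := hn n
    rw [hn1, mul_one, hh.map_one] at this
    exact one_ne_zero this
  rw [Submodule.eq_bot_iff]
  -- Now `w = ∑ w₁ ε(w₂)` vanishes, as the `w₂` can be taken in the radical.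
  intro w hw
  obtain ⟨n, hn, hcomul⟩ := hx.exists_comul_radical hh hinj u hw
  have := Coalgebra.lTensor_counit_comul (R := k) (φ w)
  rw [hcomul] at this
  simp only [map_sum, LinearMap.lTensor_tmul, hcounit _ (hn _), TensorProduct.tmul_zero,
    Finset.sum_const_zero] at this
  have h0 := congrArg (TensorProduct.rid k H) this
  simp only [map_zero, TensorProduct.rid_tmul, one_smul] at h0
  exact hinj (by rw [← h0, map_zero])

theorem isUnit_gram [DecidableEq ι] (h0 : radical h φ = ⊥) : IsUnit (gram h φ b) := by
  rw [← Matrix.mulVec_injective_iff_isUnit]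
  refine (injective_iff_map_eq_zero (Matrix.mulVecLin (gram h φ b))).2 fun c hc => ?_
  have hb : ∀ i, h (φ (b i) * φ (∑ j, c j • b j)) = 0 := fun i => by
    have := congrFun hc i
    simpa [Matrix.mulVec, dotProduct, gram, Finset.mul_sum, mul_comm] using this
  have hlin : (h ∘ₗ LinearMap.mulRight k (φ (∑ j, c j • b j)) ∘ₗ φ) = 0 := b.ext fun i => hb i
  have hmem : ∑ j, c j • b j ∈ radical h φ := fun a => LinearMap.congr_fun hlin a
  rw [h0, Submodule.mem_bot] at hmem
  exact funext fun j => Fintype.linearIndependent_iff.1 b.linearIndependent c hmem j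

end Gram

/-! ### Bijectivity and anticomultiplicativity of the antipode. -/

section Antipode

variable {k : Type*} [Field k] {H : Type*} [Ring H] [HopfAlgebra k H]

theorem map_algebraMap_mul_map_algebraMap_inv {ι : Type*} [Fintype ι] [DecidableEq ι]
    {G : Matrix ι ι k} (hG : IsUnit G) :
    G⁻¹.map (algebraMap k H) * G.map (algebraMap k H) = 1 := by
  rw [← Matrix.map_mul, Matrix.nonsing_inv_mul _ ((Matrix.isUnit_iff_isUnit_det G).1 hG)]
  simp [Matrix.map_one]

theorem map_algebraMap_inv_mul_map_algebraMap {ι : Type*} [Fintype ι] [DecidableEq ι]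
    {G : Matrix ι ι k} (hG : IsUnit G) :
    G.map (algebraMap k H) * G⁻¹.map (algebraMap k H) = 1 := by
  rw [← Matrix.map_mul, Matrix.mul_nonsing_inv _ ((Matrix.isUnit_iff_isUnit_det G).1 hG)]
  simp [Matrix.map_one]

theorem isLeftCoidealMap_id : IsLeftCoidealMap (LinearMap.id : H →ₗ[k] H) :=
  fun m => ⟨comul (R := k) m, by simp⟩

/-- For the coideal `H` itself the form is nondegenerate, so `xᵗ = G⁻¹ S(x) G`. All coefficients
then lie in the range of `S`, and they span `H`; finite dimension gives injectivity. -/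
theorem antipode_bijective [Module.Finite k H] {h : Module.Dual k H} (hh : IsHaar h) :
    Function.Bijective (HopfAlgebra.antipode k (A := H)) := by
  classical
  let b := Module.finBasis k H
  obtain ⟨x, hx⟩ := (isLeftCoidealMap_id (k := k) (H := H)).exists_isCoactionMatrix b
  have hinj : Function.Injective (LinearMap.id : H →ₗ[k] H) := Function.injective_id
  have h0 : radical h (LinearMap.id : H →ₗ[k] H) = ⊥ := by
    refine hx.radical_eq_bot hh hinj fun h1 => ?_
    rw [Submodule.map_id] at h1 ⊢
    -- The right radical of the form on all of `H` is a left ideal.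
    refine (Submodule.mul_le.2 fun a _ n hn c => ?_) h1
    have := hn (c * a)
    simpa [mul_assoc] using this
  have hG : IsUnit (gram h LinearMap.id b) := isUnit_gram h0
  have hxt : x.transpose = (gram h LinearMap.id b)⁻¹.map (algebraMap k H) *
      (x.map (HopfAlgebra.antipode k) * (gram h LinearMap.id b).map (algebraMap k H)) := by
    rw [← hx.gram_mul_transpose hh hinj, ← mul_assoc, map_algebraMap_mul_map_algebraMap_inv hG,
      one_mul]
  have hmem : ∀ i j, x i j ∈ LinearMap.range (HopfAlgebra.antipode k (A := H)) := fun i j => by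
    rw [← Matrix.transpose_apply x, hxt]
    simp only [Matrix.mul_apply, Matrix.map_apply, ← Algebra.commutes, ← Algebra.smul_def]
    exact Submodule.sum_mem _ fun l _ => Submodule.smul_mem _ _ (Submodule.sum_mem _ fun m _ =>
      Submodule.smul_mem _ _ (LinearMap.mem_range_self _ _))
  have hsurj : Function.Surjective (HopfAlgebra.antipode k (A := H)) := by
    rw [← LinearMap.range_eq_top, eq_top_iff, ← b.span_eq, Submodule.span_le]
    rintro _ ⟨i, rfl⟩
    have := congrArg (TensorProduct.rid k H) (Coalgebra.lTensor_counit_comul (R := k) (b i))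
    rw [show comul (R := k) (b i) = ∑ l, x i l ⊗ₜ[k] b l from hx i] at this
    simp only [map_sum, LinearMap.lTensor_tmul, TensorProduct.rid_tmul, one_smul] at this
    rw [SetLike.mem_coe, ← this]
    exact Submodule.sum_mem _ fun l _ => Submodule.smul_mem _ _ (hmem i l)
  exact ⟨LinearMap.injective_iff_surjective.2 hsurj, hsurj⟩

/-- Uniqueness of inverses for matrices over `H ⊗ H`: both sides, at the entries of a coaction
matrix `x` of `H`, give an inverse of `Δ(x) = (x ⊗ 1)(1 ⊗ x)`. -/
theorem comul_antipode [Module.Finite k H] (a : H) :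
    comul (R := k) (HopfAlgebra.antipode k a) = TensorProduct.map (HopfAlgebra.antipode k)
      (HopfAlgebra.antipode k) (TensorProduct.comm k H H (comul (R := k) a)) := by
  classical
  let b := Module.finBasis k H
  obtain ⟨x, hx⟩ := (isLeftCoidealMap_id (k := k) (H := H)).exists_isCoactionMatrix b
  have hc := hx.isCorep Function.injective_id
  let S := HopfAlgebra.antipode k (A := H)
  let Δ : H →+* H ⊗[k] H := (Bialgebra.comulAlgHom k H : H →+* H ⊗[k] H)
  let p : H →+* H ⊗[k] H :=
    (Algebra.TensorProduct.includeLeft : H →ₐ[k] H ⊗[k] H).toRingHom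
  let q : H →+* H ⊗[k] H :=
    (Algebra.TensorProduct.includeRight : H →ₐ[k] H ⊗[k] H).toRingHom
  have hΔ : x.map Δ = x.map p * x.map q := by
    ext i j
    simp [Matrix.mul_apply, Δ, p, q, hc.comul_eq i j]
  have hleft : (x.map S).map Δ * x.map Δ = 1 := by
    rw [← Matrix.map_mul, hc.antipode_mul]
    simp [Matrix.map_one]
  have hright : x.map Δ * ((x.map S).map q * (x.map S).map p) = 1 := by
    rw [hΔ, mul_assoc, ← mul_assoc (x.map q), ← Matrix.map_mul, hc.mul_antipode,
      Matrix.map_one _ (map_zero q) (map_one q), one_mul, ← Matrix.map_mul, hc.mul_antipode,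
      Matrix.map_one _ (map_zero p) (map_one p)]
  have hentry : ∀ i j, comul (R := k) (S (x i j)) =
      TensorProduct.map S S (TensorProduct.comm k H H (comul (R := k) (x i j))) := fun i j => by
    have := congrArg (fun y : Matrix _ _ (H ⊗[k] H) => y i j) (left_inv_eq_right_inv hleft hright)
    rw [hc.comul_eq]
    simpa [Matrix.mul_apply, Δ, p, q] using this
  have ha : ∀ i, b i = ∑ l, counit (R := k) (b l) • x i l := fun i => by
    have := congrArg (TensorProduct.rid k H) (Coalgebra.lTensor_counit_comul (R := k) (b i))
    rw [show comul (R := k) (b i) = ∑ l, x i l ⊗ₜ[k] b l from hx i] at this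
    simpa using this.symm
  have hlin : comul (R := k) ∘ₗ S =
      TensorProduct.map S S ∘ₗ (TensorProduct.comm k H H).toLinearMap ∘ₗ comul (R := k) := by
    refine b.ext fun i => ?_
    simp only [LinearMap.comp_apply, LinearEquiv.coe_coe]
    rw [ha i]
    simp only [map_sum, map_smul, hentry]
  exact LinearMap.congr_fun hlin a

end Antipode

/-! ### Commutative left coideal subalgebras: nondegeneracy, the trace and reducedness. -/

section Commutative

variable {k : Type*} [Field k] {R : Type*} [CommRing R] [Algebra k R] {H : Type*} [Ring H]

/-- Nakayama's lemma for the right action of a commutative ring `R` on `H` by `φ : R → H`. -/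
theorem one_mem_map_of_one_mem_mul [Algebra k H] [Module.Finite k H] (φ : R →ₐ[k] H)
    {N : Submodule k R} (hN : ∀ r, ∀ n ∈ N, r * n ∈ N)
    (h1 : (1 : H) ∈ (⊤ : Submodule k H) * N.map φ.toLinearMap) :
    (1 : H) ∈ N.map φ.toLinearMap := by
  let I : Ideal R :=
    { carrier := N
      zero_mem' := N.zero_mem
      add_mem' := N.add_mem
      smul_mem' := fun r n hn => hN r n hn }
  let ψ : R →+* Hᵐᵒᵖ :=
    { toFun := fun r => MulOpposite.op (φ r)
      map_one' := by simp
      map_mul' := fun r s => by rw [mul_comm, map_mul, MulOpposite.op_mul]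
      map_zero' := by simp
      map_add' := by simp }
  let : Module R H := Module.compHom H ψ
  have hsmul : ∀ (r : R) (a : H), r • a = a * φ r := fun _ _ => rfl
  have : IsScalarTower k R H := ⟨fun c r a => by simp [hsmul]⟩
  have : Module.Finite R H := Module.Finite.of_restrictScalars_finite k R H
  have key : ∀ z ∈ (⊤ : Submodule k H) * N.map φ.toLinearMap, ∀ a : H,
      a * z ∈ I • (⊤ : Submodule R H) := by
    intro z hz a
    refine Submodule.mul_induction_on hz ?_ ?_
    · rintro m - _ ⟨n, hn, rfl⟩
      rw [← mul_assoc]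
      exact Submodule.smul_mem_smul (show n ∈ I from hn) (show a * m ∈ (⊤ : Submodule R H) by trivial)
    · intro y z hy hz
      rw [mul_add]
      exact add_mem hy hz
  -- If `1 ∈ H φ(N)`, then `H = I • H`. Nakayama gives `r ∈ 1 + I` annihilating `H`; acting on `1`
  -- yields `φ r = 0`, so `1 = φ (1 - r)`.
  obtain ⟨r, hr, hr0⟩ := Submodule.exists_sub_one_mem_and_smul_eq_zero_of_fg_of_le_smul I
    (⊤ : Submodule R H) Module.Finite.fg_top fun a _ => by simpa using key 1 h1 a
  have hφr : φ r = 0 := by simpa [hsmul] using hr0 1 trivial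
  refine ⟨-(r - 1), N.neg_mem hr, ?_⟩
  simp [hφr]

variable [HopfAlgebra k H] {h : Module.Dual k H} {φ : R →ₐ[k] H}

theorem radical_eq_bot_of_isLeftCoidealMap [Module.Finite k H] [Module.Finite k R] (hh : IsHaar h)
    (hinj : Function.Injective φ) (hφ : IsLeftCoidealMap φ.toLinearMap) :
    radical h φ.toLinearMap = ⊥ := by
  classical
  obtain ⟨x, hx⟩ := hφ.exists_isCoactionMatrix (Module.finBasis k R)
  refine hx.radical_eq_bot hh hinj (one_mem_map_of_one_mem_mul φ fun r n hn a => ?_)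
  have := hn (a * r)
  simpa [mul_assoc] using this

variable {ι : Type*} [Fintype ι] [DecidableEq ι] {b : Module.Basis ι k R} {x : Matrix ι ι H}

/-- The Casimir element of the form `h(ab)`. -/
noncomputable def casimir (h : Module.Dual k H) (φ : R →ₐ[k] H) (b : Module.Basis ι k R) : R :=
  ∑ i, ∑ j, (gram h φ.toLinearMap b)⁻¹ i j • (b i * b j)

/-- Nondegeneracy turns `G xᵗ = S(x) G` into `xᵗ G⁻¹ x = G⁻¹`, which is the coinvariance of `∑ G⁻¹ᵢⱼ
bᵢ bⱼ`. -/
theorem comul_casimir (hh : IsHaar h) (hinj : Function.Injective φ)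
    (hx : IsCoactionMatrix φ.toLinearMap b x) (hG : IsUnit (gram h φ.toLinearMap b)) :
    comul (R := k) (φ (casimir h φ b)) = 1 ⊗ₜ φ (casimir h φ b) := by
  set G := gram h φ.toLinearMap b
  have hK : x.transpose * (G⁻¹.map (algebraMap k H) * x) = G⁻¹.map (algebraMap k H) := by
    have hxt : x.transpose = G⁻¹.map (algebraMap k H) *
        (x.map (HopfAlgebra.antipode k) * G.map (algebraMap k H)) := by
      rw [← hx.gram_mul_transpose hh hinj, ← mul_assoc, map_algebraMap_mul_map_algebraMap_inv hG,
        one_mul]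
    rw [hxt, mul_assoc, mul_assoc, ← mul_assoc (G.map _), map_algebraMap_inv_mul_map_algebraMap hG,
      one_mul, (hx.isCorep hinj).antipode_mul, mul_one]
  have hentry : ∀ l m, ∑ i, ∑ j, G⁻¹ i j • (x i l * x j m) = algebraMap k H (G⁻¹ l m) := by
    intro l m
    have := congrArg (fun y : Matrix ι ι H => y l m) hK
    simp only [Matrix.mul_apply, Matrix.map_apply, Matrix.transpose_apply, Finset.mul_sum] at this
    rw [← this]
    refine Finset.sum_congr rfl fun i _ => Finset.sum_congr rfl fun j _ => ?_
    rw [← Algebra.smul_def, mul_smul_comm]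
  have hx' : ∀ i, comul (R := k) (φ (b i)) = ∑ l, x i l ⊗ₜ[k] φ (b l) := hx
  have hc : φ (casimir h φ b) = ∑ i, ∑ j, G⁻¹ i j • (φ (b i) * φ (b j)) := by
    simp [casimir, G]
  have hr : (1 : H) ⊗ₜ[k] φ (casimir h φ b) = ∑ l, ∑ m, ∑ i, ∑ j,
      G⁻¹ i j • ((x i l * x j m) ⊗ₜ[k] (φ (b l) * φ (b m))) := by
    rw [hc]
    simp only [TensorProduct.tmul_sum, TensorProduct.tmul_smul, TensorProduct.smul_tmul',
      ← TensorProduct.sum_tmul, hentry, Algebra.algebraMap_eq_smul_one]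
  rw [hr, hc]
  simp only [map_sum, map_smul, Bialgebra.comul_mul, hx', Finset.sum_mul_sum,
    Algebra.TensorProduct.tmul_mul_tmul, Finset.smul_sum]
  have hswap : ∀ F : ι → ι → ι → ι → H ⊗[k] H,
      ∑ i, ∑ j, ∑ l, ∑ m, F i j l m = ∑ l, ∑ m, ∑ i, ∑ j, F i j l m := fun F => by
    have := Finset.sum_comm (s := Finset.univ) (t := Finset.univ)
      (f := fun p q : ι × ι => F p.1 p.2 q.1 q.2)
    simpa only [Fintype.sum_prod_type] using this
  exact hswap _

theorem casimir_eq_algebraMap (hh : IsHaar h) (hinj : Function.Injective φ)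
    (hx : IsCoactionMatrix φ.toLinearMap b x) (hG : IsUnit (gram h φ.toLinearMap b)) :
    casimir h φ b = algebraMap k R (counit (R := k) (φ (casimir h φ b))) := by
  have := Coalgebra.lTensor_counit_comul (R := k) (φ (casimir h φ b))
  rw [comul_casimir hh hinj hx hG] at this
  have := congrArg (TensorProduct.rid k H) this
  simp only [LinearMap.lTensor_tmul, TensorProduct.rid_tmul, one_smul] at this
  refine hinj ?_
  rw [AlgHom.commutes, ← this, Algebra.algebraMap_eq_smul_one]
  simp

theorem repr_eq_sum_gram_inv (hG : IsUnit (gram h φ.toLinearMap b)) (w : R) (i : ι) :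
    b.repr w i = ∑ j, (gram h φ.toLinearMap b)⁻¹ i j * h (φ (b j) * φ w) := by
  set G := gram h φ.toLinearMap b
  have hw : ∀ j, h (φ (b j) * φ w) = G.mulVec (b.repr w) j := fun j => by
    have hφw : φ w = ∑ l, b.repr w l • φ (b l) := by
      simpa only [map_sum, map_smul] using congrArg φ (b.sum_repr w).symm
    rw [hφw]
    simp [Matrix.mulVec, dotProduct, G, gram, Finset.mul_sum, mul_comm]
  have : b.repr w = G⁻¹.mulVec (G.mulVec (b.repr w)) := by
    rw [Matrix.mulVec_mulVec, Matrix.nonsing_inv_mul _ ((Matrix.isUnit_iff_isUnit_det G).1 hG),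
      Matrix.one_mulVec]
  rw [this]
  simp only [Matrix.mulVec, dotProduct, hw]

/-- The `i`-th coordinate of `a bᵢ` is `∑ⱼ G⁻¹ᵢⱼ h(bⱼ a bᵢ)`; commutativity of `R` collects the sum
over `i` into `h(a c)`, `c` the Casimir element. -/
theorem trace_eq_haar_mul_casimir (hG : IsUnit (gram h φ.toLinearMap b)) (a : R) :
    Algebra.trace k R a = h (φ (a * casimir h φ b)) := by
  rw [Algebra.trace_eq_matrix_trace b, Matrix.trace]
  simp only [Matrix.diag_apply, Algebra.leftMulMatrix_eq_repr_mul, repr_eq_sum_gram_inv hG, casimir,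
    Finset.mul_sum, map_sum, mul_smul_comm, map_smul, smul_eq_mul, ← map_mul]
  refine Finset.sum_congr rfl fun i _ => Finset.sum_congr rfl fun j _ => ?_
  rw [show b j * (a * b i) = a * (b i * b j) by ring]

/-- The trace form of a commutative left coideal subalgebra is a multiple of the Haar form. -/
theorem trace_eq_finrank_mul_haar [Module.Finite k H] [Module.Finite k R] (hh : IsHaar h)
    (hinj : Function.Injective φ) (hφ : IsLeftCoidealMap φ.toLinearMap) (a : R) :
    Algebra.trace k R a = Module.finrank k R * h (φ a) := by
  classical
  obtain ⟨x, hx⟩ := hφ.exists_isCoactionMatrix (Module.finBasis k R)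
  have hG : IsUnit (gram h φ.toLinearMap (Module.finBasis k R)) :=
    isUnit_gram (radical_eq_bot_of_isLeftCoidealMap hh hinj hφ)
  have htr : ∀ a, Algebra.trace k R a =
      counit (R := k) (φ (casimir h φ (Module.finBasis k R))) * h (φ a) := fun a => by
    rw [trace_eq_haar_mul_casimir hG, casimir_eq_algebraMap hh hinj hx hG, map_mul, AlgHom.commutes,
      ← Algebra.commutes, ← Algebra.smul_def, map_smul, smul_eq_mul]
    simp
  -- The scalar is found at `a = 1`, where the trace is `dim R` and `h` is `1`.
  have h1 := htr 1
  rw [map_one φ, hh.map_one, mul_one, ← map_one (algebraMap k R),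
    Algebra.trace_algebraMap, nsmul_eq_mul, mul_one] at h1
  rw [htr, h1]

theorem finrank_ne_zero_of_injective [CharZero k] [Module.Finite k R] [Nontrivial R] :
    (Module.finrank k R : k) ≠ 0 :=
  Nat.cast_ne_zero.2 Module.finrank_pos.ne'

/-- For `a` nilpotent every `c a` has trace zero, hence `h(ca) = 0` because `dim R ≠ 0` in `k`. So
`a` lies in the radical, which is zero. -/
theorem isReduced_of_isLeftCoidealMap [CharZero k] [Module.Finite k H] [Module.Finite k R]
    (hh : IsHaar h) (hinj : Function.Injective φ) (hφ : IsLeftCoidealMap φ.toLinearMap) :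
    IsReduced R := by
  rcases subsingleton_or_nontrivial R with hR | hR
  · infer_instance
  refine ⟨fun a ha => ?_⟩
  have hmem : a ∈ radical h φ.toLinearMap := fun c => by
    have hn : IsNilpotent (c * a) := (Commute.all c a).isNilpotent_mul_left ha
    have := (Algebra.isNilpotent_trace_of_isNilpotent (R := k) hn).eq_zero
    rw [trace_eq_finrank_mul_haar hh hinj hφ, mul_eq_zero] at this
    simpa using this.resolve_left finrank_ne_zero_of_injective
  rwa [radical_eq_bot_of_isLeftCoidealMap hh hinj hφ, Submodule.mem_bot] at hmem

end Commutative

/-! ### Splitting of reduced commutative algebras. -/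

section Split

/-- A finite-dimensional reduced commutative algebra over an algebraically closed field has a basis
of orthogonal idempotents with sum `1`. -/
theorem exists_basis_idempotents (k : Type*) [Field k] [IsAlgClosed k] (R : Type*) [CommRing R]
    [Algebra k R] [Module.Finite k R] [IsReduced R] :
    ∃ (n : ℕ) (e : Module.Basis (Fin n) k R),
      (∀ i j, e i * e j = if i = j then e i else 0) ∧ ∑ i, e i = 1 := by
  classical
  have : IsArtinianRing R := IsArtinianRing.of_finite k R
  let F (I : MaximalSpectrum R) : k ≃ₐ[k] R ⧸ I.asIdeal :=
    AlgEquiv.ofBijective (Algebra.ofId k (R ⧸ I.asIdeal))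
      (IsAlgClosed.algebraMap_bijective_of_isIntegral (k := k))
  let E : R ≃ₐ[k] (MaximalSpectrum R → k) :=
    ((IsArtinianRing.equivPi R).restrictScalars k).trans (AlgEquiv.piCongrRight F).symm
  let := Fintype.ofFinite (MaximalSpectrum R)
  let σ := Fintype.equivFin (MaximalSpectrum R)
  refine ⟨_, ((Pi.basisFun k (MaximalSpectrum R)).map E.symm.toLinearEquiv).reindex σ,
    fun i j => ?_, ?_⟩
  · apply E.injective
    rw [map_mul, apply_ite E]
    ext I
    simp only [Module.Basis.reindex_apply, Module.Basis.map_apply, Pi.basisFun_apply,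
      AlgEquiv.toLinearEquiv_apply, AlgEquiv.apply_symm_apply, map_zero, Pi.mul_apply]
    split_ifs with h
    · subst h
      simp [Pi.single_apply]
    · by_cases hi : I = σ.symm i
      · subst hi
        simp [h]
      · simp [hi]
  · apply E.injective
    ext I
    simp [Finset.sum_apply, Pi.single_apply, Equiv.eq_symm_apply]

end Split

/-! ### Magic corepresentation matrices and Hopf algebra maps from `As k n`. -/

section MagicCorepresentation

variable {k : Type*} [Field k] {H : Type*} [Ring H] [HopfAlgebra k H]

/-- A corepresentation matrix which is magic. -/
structure IsMagicCorep {ι : Type*} [Fintype ι] [DecidableEq ι] (x : Matrix ι ι H) : Prop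
    extends IsCorep (k := k) x where
  row_mul : ∀ i j l, x i j * x i l = if j = l then x i j else 0
  col_mul : ∀ i j l, x i j * x l j = if i = l then x i j else 0
  row_sum : ∀ i, ∑ l, x i l = 1
  col_sum : ∀ i, ∑ l, x l i = 1

variable {ι κ : Type*} [Fintype ι] [DecidableEq ι] [Fintype κ] [DecidableEq κ]

theorem isMagicCorep_one : IsMagicCorep (k := k) (1 : Matrix Unit Unit H) where
  comul_eq i j := by simp [Algebra.TensorProduct.one_def]
  counit_eq i j := by simp
  row_mul i j l := by simp
  col_mul i j l := by simp
  row_sum i := by simp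
  col_sum i := by simp

theorem IsMagicCorep.fromBlocks {x : Matrix ι ι H} {y : Matrix κ κ H}
    (hx : IsMagicCorep (k := k) x) (hy : IsMagicCorep (k := k) y) :
    IsMagicCorep (k := k) (Matrix.fromBlocks x 0 0 y) where
  comul_eq i j := by
    rcases i with i | i <;> rcases j with j | j <;> simp [hx.comul_eq, hy.comul_eq]
  counit_eq i j := by
    rcases i with i | i <;> rcases j with j | j <;> simp [hx.counit_eq, hy.counit_eq]
  row_mul i j l := by
    rcases i with i | i <;> rcases j with j | j <;> rcases l with l | l <;>
      simp [hx.row_mul, hy.row_mul]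
  col_mul i j l := by
    rcases i with i | i <;> rcases j with j | j <;> rcases l with l | l <;>
      simp [hx.col_mul, hy.col_mul]
  row_sum i := by rcases i with i | i <;> simp [hx.row_sum, hy.row_sum]
  col_sum i := by rcases i with i | i <;> simp [hx.col_sum, hy.col_sum]

theorem IsMagicCorep.reindex {x : Matrix ι ι H} (hx : IsMagicCorep (k := k) x) (σ : ι ≃ κ) :
    IsMagicCorep (k := k) (x.reindex σ σ) where
  comul_eq i j := by
    simp only [Matrix.reindex_apply, Matrix.submatrix_apply, hx.comul_eq]
    exact (Equiv.sum_comp σ.symm fun l => x (σ.symm i) l ⊗ₜ[k] x l (σ.symm j)).symm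
  counit_eq i j := by simp [hx.counit_eq]
  row_mul i j l := by simp [hx.row_mul]
  col_mul i j l := by simp [hx.col_mul]
  row_sum i := by
    simp only [Matrix.reindex_apply, Matrix.submatrix_apply]
    rw [Equiv.sum_comp σ.symm fun l => x (σ.symm i) l, hx.row_sum]
  col_sum i := by
    simp only [Matrix.reindex_apply, Matrix.submatrix_apply]
    rw [Equiv.sum_comp σ.symm fun l => x l (σ.symm i), hx.col_sum]

/-- The magic relations give `x xᵗ = 1`, while `S(x) x = 1`. -/
theorem IsMagicCorep.antipode_eq {x : Matrix ι ι H} (hx : IsMagicCorep (k := k) x) (i j : ι) :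
    HopfAlgebra.antipode k (x i j) = x j i := by
  have h : x * x.transpose = 1 := by
    ext i j
    simp only [Matrix.mul_apply, Matrix.transpose_apply, hx.col_mul, Matrix.one_apply]
    split_ifs <;> simp [hx.row_sum]
  exact congrArg (fun y : Matrix ι ι H => y i j)
    (left_inv_eq_right_inv hx.toIsCorep.antipode_mul h)

theorem IsMagicCorep.isMagic {n : ℕ} {x : Matrix (Fin n) (Fin n) H}
    (hx : IsMagicCorep (k := k) x) : IsMagic fun i j => x i j :=
  ⟨hx.row_mul, hx.col_mul, hx.row_sum, hx.col_sum⟩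

/-- A magic corepresentation matrix defines a Hopf algebra map from Wang's algebra. -/
noncomputable def IsMagicCorep.lift {n : ℕ} {x : Matrix (Fin n) (Fin n) H}
    (hx : IsMagicCorep (k := k) x) : As k n →ₐc[k] H :=
  BialgHom.ofAlgHom (liftAs (fun i j => x i j) hx.isMagic)
    (algHom_ext_As fun i j => by
      have h : Bialgebra.counitAlgHom k (As k n) (u i j) = _ := counitAs_u i j
      rw [AlgHom.comp_apply, liftAs_u, h]
      exact hx.counit_eq i j)
    (algHom_ext_As fun i j => by
      have h : Bialgebra.comulAlgHom k (As k n) (u i j) = _ := comulAs_u i j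
      rw [AlgHom.comp_apply, AlgHom.comp_apply, liftAs_u, h, map_sum]
      simp only [Algebra.TensorProduct.map_tmul]
      refine Eq.trans ?_ (hx.comul_eq i j).symm
      exact Finset.sum_congr rfl fun l _ => by rw [liftAs_u, liftAs_u])

theorem IsMagicCorep.lift_u {n : ℕ} {x : Matrix (Fin n) (Fin n) H}
    (hx : IsMagicCorep (k := k) x) (i j : Fin n) : hx.lift (u i j) = x i j :=
  liftAs_u _ hx.isMagic i j

theorem isMagicCorep_map_u {n : ℕ} (f : As k n →ₐc[k] H) :
    IsMagicCorep (k := k) (Matrix.of fun i j => f (u i j)) where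
  comul_eq i j := by
    have h : comul (R := k) (u i j : As k n) = _ := comulAs_u i j
    rw [Matrix.of_apply, ← CoalgHomClass.map_comp_comul_apply, h]
    simp
  counit_eq i j := by
    have h : counit (R := k) (u i j : As k n) = _ := counitAs_u i j
    rw [Matrix.of_apply, CoalgHomClass.counit_comp_apply, h]
  row_mul i j l := by
    rw [Matrix.of_apply, Matrix.of_apply, ← map_mul, isMagic_u.row_mul]
    split_ifs <;> simp
  col_mul i j l := by
    rw [Matrix.of_apply, Matrix.of_apply, ← map_mul, isMagic_u.col_mul]
    split_ifs <;> simp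
  row_sum i := by simp [← map_sum, isMagic_u.row_sum]
  col_sum i := by simp [← map_sum, isMagic_u.col_sum]

theorem map_mem_of_map_u_mem {n : ℕ} (f : As k n →ₐc[k] H) (A : Subalgebra k H)
    (hA : ∀ i j, f (u i j) ∈ A) (a : As k n) : f a ∈ A := by
  induction a using induction_As with
  | hs r =>
    rw [AlgHomClass.commutes]
    exact A.algebraMap_mem r
  | hu i j => exact hA i j
  | hm a b ha hb =>
    rw [map_mul]
    exact A.mul_mem ha hb
  | ha a b ha hb =>
    rw [map_add]
    exact A.add_mem ha hb

/-- The subalgebra of `H` generated by the entries of a matrix. -/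
def entries (k : Type*) [Field k] {H : Type*} [Ring H] [Algebra k H] {ι : Type*}
    (x : Matrix ι ι H) : Subalgebra k H :=
  Algebra.adjoin k (Set.range fun p : ι × ι => x p.1 p.2)

theorem mem_entries {ι : Type*} (x : Matrix ι ι H) (i j : ι) : x i j ∈ entries k x :=
  Algebra.subset_adjoin ⟨(i, j), rfl⟩

theorem entries_le {ι : Type*} {x : Matrix ι ι H} {A : Subalgebra k H} (hA : ∀ i j, x i j ∈ A) :
    entries k x ≤ A :=
  Algebra.adjoin_le (by rintro _ ⟨p, rfl⟩; exact hA p.1 p.2)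

theorem IsMagicCorep.antipode_mem_entries {x : Matrix ι ι H} (hx : IsMagicCorep (k := k) x)
    {a : H} (ha : a ∈ entries k x) : HopfAlgebra.antipode k a ∈ entries k x := by
  induction ha using Algebra.adjoin_induction with
  | mem a ha =>
    obtain ⟨p, rfl⟩ := ha
    rw [hx.antipode_eq]
    exact mem_entries x _ _
  | algebraMap r =>
    rw [Algebra.algebraMap_eq_smul_one, map_smul, HopfAlgebra.antipode_one]
    exact Subalgebra.smul_mem _ (one_mem _) r
  | add a b _ _ ha hb =>
    rw [map_add]
    exact add_mem ha hb
  | mul a b _ _ ha hb =>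
    rw [HopfAlgebra.antipode_mul_antidistrib]
    exact mul_mem hb ha

theorem IsMagicCorep.isQuantumPermutationAlgebra [Nonempty ι] {x : Matrix ι ι H}
    (hx : IsMagicCorep (k := k) x) (htop : entries k x = ⊤) : IsQuantumPermutationAlgebra k H := by
  refine ⟨Fintype.card ι, Fintype.card_pos, (hx.reindex (Fintype.equivFin ι)).lift, fun a => ?_⟩
  set f := (hx.reindex (Fintype.equivFin ι)).lift
  have hle : entries k x ≤ (f : As k (Fintype.card ι) →ₐ[k] H).range :=
    entries_le fun i j => ⟨u (Fintype.equivFin ι i) (Fintype.equivFin ι j), by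
      simp [f, IsMagicCorep.lift_u]⟩
  obtain ⟨y, hy⟩ := hle (show a ∈ entries k x by rw [htop]; trivial)
  exact ⟨y, hy⟩

/-- Among the subalgebras generated by a magic corepresentation matrix there is a largest one. -/
theorem exists_isMagicCorep_entries_largest (k : Type*) [Field k] (H : Type*) [Ring H]
    [HopfAlgebra k H] [Module.Finite k H] :
    ∃ (m : ℕ) (x : Matrix (Fin m) (Fin m) H), 0 < m ∧ IsMagicCorep (k := k) x ∧
      ∀ (n : ℕ) (y : Matrix (Fin n) (Fin n) H), IsMagicCorep (k := k) y →
        entries k y ≤ entries k x := by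
  let P : Set (Submodule k H) := {V | ∃ (m : ℕ) (x : Matrix (Fin m) (Fin m) H), 0 < m ∧
    IsMagicCorep (k := k) x ∧ Subalgebra.toSubmodule (entries k x) = V}
  have hne : P.Nonempty :=
    ⟨_, 1, _, one_pos, isMagicCorep_one.reindex (Equiv.ofUnique Unit (Fin 1)), rfl⟩
  obtain ⟨_, ⟨m, x, hm, hx, rfl⟩, hmax⟩ := wellFounded_gt.has_min P hne
  refine ⟨m, x, hm, hx, fun n y hy => ?_⟩
  -- The block sum generates a subalgebra containing the entries of both `x` and `y`; maximality for
  -- `x` then absorbs `y`.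
  let z := (Matrix.fromBlocks x 0 0 y).reindex finSumFinEquiv finSumFinEquiv
  have hz : IsMagicCorep (k := k) z := (hx.fromBlocks hy).reindex finSumFinEquiv
  have hxz : entries k x ≤ entries k z := entries_le fun i j => by
    simpa [z] using mem_entries (k := k) z (finSumFinEquiv (.inl i)) (finSumFinEquiv (.inl j))
  have hyz : entries k y ≤ entries k z := entries_le fun i j => by
    simpa [z] using mem_entries (k := k) z (finSumFinEquiv (.inr i)) (finSumFinEquiv (.inr j))
  have hnot := hmax _ ⟨m + n, z, by omega, hz, rfl⟩
  have heq : entries k x = entries k z := by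
    by_contra hne
    exact hnot (Subalgebra.toSubmodule.lt_iff_lt.2 (lt_of_le_of_ne hxz hne))
  rwa [heq]

end MagicCorepresentation

/-! ### The coaction in the basis of minimal idempotents. -/

section MagicCoaction

variable {k : Type*} [Field k] [IsAlgClosed k] [CharZero k] {R : Type*} [CommRing R] [Algebra k R]
  [Module.Finite k R] {H : Type*} [Ring H] [HopfAlgebra k H] [Module.Finite k H]

/-- The coaction on a commutative left coideal subalgebra is given by a magic matrix. -/
theorem exists_isMagicCorep_of_isLeftCoidealMap {h : Module.Dual k H} (hh : IsHaar h)
    {φ : R →ₐ[k] H} (hinj : Function.Injective φ) (hφ : IsLeftCoidealMap φ.toLinearMap) :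
    ∃ (n : ℕ) (e : Module.Basis (Fin n) k R) (x : Matrix (Fin n) (Fin n) H),
      IsMagicCorep (k := k) x ∧ IsCoactionMatrix φ.toLinearMap e x := by
  have := isReduced_of_isLeftCoidealMap hh hinj hφ
  have := nontrivial_of_hopfAlgebra k H
  have : Nontrivial R := φ.toRingHom.domain_nontrivial
  obtain ⟨n, e, hmul, hsum⟩ := exists_basis_idempotents k R
  obtain ⟨x, hx⟩ := hφ.exists_isCoactionMatrix e
  have hli := linearIndependent_comp_basis (φ := φ.toLinearMap) hinj e
  have hx' : ∀ i, comul (R := k) (φ (e i)) = ∑ l, x i l ⊗ₜ[k] φ (e l) := hx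
  -- The column relations express that `Δ` respects `eᵢ eₗ = δᵢₗ eᵢ` and `∑ eᵢ = 1`.
  have hcol_mul : ∀ i j l, x i j * x l j = if i = l then x i j else 0 := fun i j l => by
    have := congrArg (fun a => comul (R := k) (φ a)) (hmul i l)
    simp only [map_mul, Bialgebra.comul_mul, hx', Finset.sum_mul_sum,
      Algebra.TensorProduct.tmul_mul_tmul] at this
    simp only [← map_mul, hmul, apply_ite φ, map_zero, TensorProduct.tmul_ite,
      Finset.sum_ite_eq, Finset.mem_univ, if_true] at this
    refine congrFun (sum_tmul_right_injective hli (y := fun j => x i j * x l j)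
      (z := fun j => if i = l then x i j else 0) ?_) j
    refine this.trans ?_
    split_ifs
    · exact hx' i
    · simp
  have hcol_sum : ∀ j, ∑ l, x l j = 1 := fun j => by
    refine congrFun (sum_tmul_right_injective hli (y := fun j => ∑ l, x l j) (z := fun _ => 1) ?_) j
    have := congrArg (fun a => comul (R := k) (φ a)) hsum
    simp only [map_sum, hx', map_one φ, Bialgebra.comul_one, Algebra.TensorProduct.one_def] at this
    simp only [AlgHom.toLinearMap_apply, TensorProduct.sum_tmul, ← TensorProduct.tmul_sum]
    rw [Finset.sum_comm, this, ← map_sum, hsum, map_one]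
  have htrace : ∀ i, Algebra.trace k R (e i) = 1 := fun i => by
    rw [Algebra.trace_eq_matrix_trace e, Matrix.trace]
    simp only [Matrix.diag_apply, Algebra.leftMulMatrix_eq_repr_mul, hmul]
    rw [Finset.sum_eq_single i (fun j _ hj => by simp [hj.symm]) (by simp)]
    simp
  have hd : (Module.finrank k R : k) ≠ 0 := finrank_ne_zero_of_injective
  -- Each `eᵢ` has trace `1`, so `h(eᵢ) = 1 / dim R`. A scalar Gram matrix turns `G xᵗ = S(x) G`
  -- into `xᵗ = S(x)`, and `x` is orthogonal.
  have hgram : gram h φ.toLinearMap e = (Module.finrank k R : k)⁻¹ • 1 := by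
    ext i j
    have hi : h (φ (e i)) = (Module.finrank k R : k)⁻¹ := by
      refine eq_inv_of_mul_eq_one_right ?_
      rw [← trace_eq_finrank_mul_haar hh hinj hφ, htrace]
    simp only [gram, Matrix.of_apply, AlgHom.toLinearMap_apply, ← map_mul, hmul, Matrix.smul_apply,
      Matrix.one_apply]
    split_ifs <;> simp [hi]
  have hcorep : IsCorep (k := k) x := hx.isCorep hinj
  have hS : x.transpose = x.map (HopfAlgebra.antipode k) := by
    have := hx.gram_mul_transpose hh hinj
    ext i j
    have hij := congrArg (fun y : Matrix _ _ H => y i j) this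
    simp only [hgram, Matrix.mul_apply, Matrix.map_apply, Matrix.smul_apply, Matrix.one_apply,
      smul_eq_mul, mul_ite, mul_one, mul_zero, apply_ite (algebraMap k H), map_zero, ite_mul,
      zero_mul, Finset.sum_ite_eq, Finset.sum_ite_eq', Finset.mem_univ, if_true] at hij
    rw [← Algebra.commutes, ← Algebra.smul_def, ← Algebra.smul_def] at hij
    exact smul_right_injective H (inv_ne_zero hd) hij
  have hxx : ∀ i j, ∑ l, x l i * x l j = if i = j then 1 else 0 := fun i j => by
    have := congrArg (fun y : Matrix _ _ H => y i j) hcorep.antipode_mul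
    rwa [← hS] at this
  have hxx' : ∀ i j, ∑ l, x i l * x j l = if i = j then 1 else 0 := fun i j => by
    have := congrArg (fun y : Matrix _ _ H => y i j) hcorep.mul_antipode
    rwa [← hS] at this
  refine ⟨n, e, x, { hcorep with
    row_mul := fun i j l => ?_
    col_mul := hcol_mul
    row_sum := fun i => ?_
    col_sum := hcol_sum }, hx⟩
  -- In `x i j * ∑ₘ x m j * x m l = δⱼₗ x i j` the column relations leave only the term `m = i`.
  · have := congrArg (fun z => x i j * z) (hxx j l)
    simp only [Finset.mul_sum, ← mul_assoc, hcol_mul, ite_mul, zero_mul, Finset.sum_ite_eq,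
      Finset.mem_univ, if_true, mul_ite, mul_one, mul_zero] at this
    exact this
  -- Orthogonality gives `∑ₗ (x i l)² = 1`, and the entries are idempotent.
  · simpa [hcol_mul] using hxx' i i

end MagicCoaction

/-! ### Generation by coefficients gives a quotient of `As k n`. -/

section Generation

variable {k : Type*} [Field k] {H : Type*} [Ring H] [HopfAlgebra k H]

theorem exists_magic_coefficients [IsAlgClosed k] [CharZero k] [Module.Finite k H]
    {h : Module.Dual k H} (hh : IsHaar h) {R : Type*} [CommRing R]
    [Algebra k R] {φ : R →ₐ[k] H} (hinj : Function.Injective φ)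
    (hφ : IsLeftCoidealMap φ.toLinearMap) :
    ∃ (n : ℕ) (x : Matrix (Fin n) (Fin n) H), IsMagicCorep (k := k) x ∧
      ∀ (r : R) (t : H ⊗[k] R), φ.toLinearMap.lTensor H t = comul (R := k) (φ r) →
        ∀ f : Module.Dual k R, TensorProduct.rid k H (f.lTensor H t) ∈ entries k x := by
  have : Module.Finite k R := Module.Finite.of_injective φ.toLinearMap hinj
  obtain ⟨n, e, x, hm, hx⟩ := exists_isMagicCorep_of_isLeftCoidealMap hh hinj hφ
  exact ⟨n, x, hm, fun r t ht f =>
    hx.coefficient_mem hinj (A := Subalgebra.toSubmodule (entries k x)) (mem_entries x) ht f⟩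

theorem isQuantumPermutationAlgebra_of_isGeneratedByLeft [IsAlgClosed k] [CharZero k]
    [Module.Finite k H] (hH : IsCosemisimple k H) (hgen : IsGeneratedByLeft k H) : IsQuantumPermutationAlgebra k H := by
  obtain ⟨h, hh⟩ := exists_isHaar hH
  obtain ⟨m, x, hm, hx, hmax⟩ := exists_isMagicCorep_entries_largest k H
  have : Nonempty (Fin m) := ⟨⟨0, hm⟩⟩
  refine hx.isQuantumPermutationAlgebra (eq_top_iff.2 (hgen ▸ Algebra.adjoin_le ?_))
  rintro _ ⟨L, hL, hcomm, r, hr, t, ht, f, rfl⟩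
  let : CommRing L := { L.toRing with mul_comm := fun a b => Subtype.ext (hcomm a a.2 b b.2) }
  obtain ⟨n, y, hy, hcoef⟩ := exists_magic_coefficients hh (φ := L.val) Subtype.val_injective
    (fun a => hL a a.2)
  exact hmax n y hy (hcoef ⟨r, hr⟩ t ht f)

/-- The injective `S` maps the finite-dimensional algebra of entries into itself, hence onto itself.
-/
theorem IsMagicCorep.mem_entries_of_antipode_mem [Module.Finite k H] {h : Module.Dual k H}
    (hh : IsHaar h) {ι : Type*} [Fintype ι] [DecidableEq ι] {x : Matrix ι ι H} (hx : IsMagicCorep (k := k) x) {a : H}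
    (ha : HopfAlgebra.antipode k a ∈ entries k x) : a ∈ entries k x := by
  have hbij := antipode_bijective hh
  set V := Subalgebra.toSubmodule (entries k x) with hV
  have hle : V.map (HopfAlgebra.antipode k) ≤ V := by
    rintro _ ⟨b, hb, rfl⟩
    exact hx.antipode_mem_entries hb
  have heq : V.map (HopfAlgebra.antipode k) = V :=
    Submodule.eq_of_le_of_finrank_eq hle (LinearEquiv.finrank_eq
      (Submodule.equivMapOfInjective _ hbij.1 V)).symm
  obtain ⟨b, hb, hba⟩ : HopfAlgebra.antipode k a ∈ V.map (HopfAlgebra.antipode k) := by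
    rw [heq]
    exact ha
  rwa [← hbij.1 hba]

/-- The antipode turns the coaction on a right coideal into a coaction on a left coideal. -/
theorem lTensor_antipode_comp_eq_comul [Module.Finite k H] {M : Type*} [AddCommGroup M]
    [Module k M] (φ : M →ₗ[k] H)
    {s : M ⊗[k] H} {a : H} (hs : φ.rTensor H s = comul (R := k) a) :
    (HopfAlgebra.antipode k ∘ₗ φ).lTensor H
        (TensorProduct.comm k M H ((HopfAlgebra.antipode k).lTensor M s)) =
      comul (R := k) (HopfAlgebra.antipode k a) := by
  rw [comul_antipode, ← hs]
  clear hs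
  induction s with
  | zero => simp
  | tmul p q => simp
  | add p q hp hq => rw [map_add, map_add, map_add, hp, hq, map_add, map_add, map_add]

theorem rid_lTensor_antipode {M : Type*} [AddCommGroup M] [Module k M] (f : Module.Dual k M)
    (s : M ⊗[k] H) :
    TensorProduct.rid k H (f.lTensor H
        (TensorProduct.comm k M H ((HopfAlgebra.antipode k).lTensor M s))) =
      HopfAlgebra.antipode k (TensorProduct.lid k H (f.rTensor H s)) := by
  induction s with
  | zero => simp
  | tmul p q => simp
  | add p q hp hq =>
    rw [map_add, map_add, map_add, map_add, hp, hq, map_add, map_add, map_add]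

theorem isQuantumPermutationAlgebra_of_isGeneratedByRight [IsAlgClosed k] [CharZero k]
    [Module.Finite k H] (hH : IsCosemisimple k H) (hgen : IsGeneratedByRight k H) : IsQuantumPermutationAlgebra k H := by
  obtain ⟨h, hh⟩ := exists_isHaar hH
  obtain ⟨m, x, hm, hx, hmax⟩ := exists_isMagicCorep_entries_largest k H
  have : Nonempty (Fin m) := ⟨⟨0, hm⟩⟩
  refine hx.isQuantumPermutationAlgebra (eq_top_iff.2 (hgen ▸ Algebra.adjoin_le ?_))
  rintro _ ⟨L, hL, hcomm, r, hr, t, ht, f, rfl⟩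
  let : CommRing L := { L.toRing with mul_comm := fun a b => Subtype.ext (hcomm a a.2 b b.2) }
  -- On the commutative `L` the antimultiplicative `S` is an algebra map, and it makes the right
  -- coideal `L` a left one.
  let φ : L →ₐ[k] H := AlgHom.ofLinearMap (HopfAlgebra.antipode k ∘ₗ L.val.toLinearMap)
    HopfAlgebra.antipode_one fun a b => by
      rw [mul_comm]
      exact HopfAlgebra.antipode_mul_antidistrib _ _
  obtain ⟨n, y, hy, hcoef⟩ := exists_magic_coefficients hh (φ := φ)
    ((antipode_bijective hh).1.comp Subtype.val_injective)
    (fun a => by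
      obtain ⟨s, hs⟩ := hL a a.2
      exact ⟨_, lTensor_antipode_comp_eq_comul L.val.toLinearMap hs⟩)
  -- The coefficients of `S(L)` are the images under `S` of those of `L`, so `S` has to be undone.
  refine hmax n y hy (hy.mem_entries_of_antipode_mem hh ?_)
  have := hcoef ⟨r, hr⟩ _ (lTensor_antipode_comp_eq_comul L.val.toLinearMap ht) f
  rwa [rid_lTensor_antipode] at this

end Generation

/-! ### Quantum permutation algebras are generated by coefficients of columns and rows. -/

section Columns

variable {k : Type*} [Field k] {H : Type*} [Ring H]

/-- The subalgebra spanned by orthogonal idempotents with sum `1`. -/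
def idempotentSpan [Algebra k H] {ι : Type*} [Fintype ι] [DecidableEq ι] (e : ι → H)
    (hmul : ∀ i j, e i * e j = if i = j then e i else 0) (hsum : ∑ i, e i = 1) :
    Subalgebra k H :=
  (Submodule.span k (Set.range e)).toSubalgebra
    (hsum ▸ Submodule.sum_mem _ fun i _ => Submodule.subset_span ⟨i, rfl⟩)
    fun a b ha hb => by
      have h := Submodule.mul_mem_mul ha hb
      rw [Submodule.span_mul_span] at h
      refine Submodule.span_le.2 ?_ h
      rintro _ ⟨_, ⟨i, rfl⟩, _, ⟨j, rfl⟩, rfl⟩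
      simp only [hmul]
      split_ifs
      · exact Submodule.subset_span ⟨i, rfl⟩
      · exact Submodule.zero_mem _

section

variable [Algebra k H] {ι : Type*} [Fintype ι] [DecidableEq ι] {e : ι → H}
  {hmul : ∀ i j, e i * e j = if i = j then e i else 0} {hsum : ∑ i, e i = 1}

theorem mul_comm_of_mem_idempotentSpan :
    ∀ a ∈ idempotentSpan (k := k) e hmul hsum, ∀ b ∈ idempotentSpan (k := k) e hmul hsum,
      a * b = b * a := by
  have h : ∀ i, ∀ b ∈ Submodule.span k (Set.range e), e i * b = b * e i := fun i b hb => by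
    induction hb using Submodule.span_induction with
    | mem b hb =>
      obtain ⟨j, rfl⟩ := hb
      rw [hmul, hmul]
      split_ifs <;> simp_all
    | zero => simp
    | add b c _ _ hb hc => rw [mul_add, add_mul, hb, hc]
    | smul r b _ hb => rw [mul_smul_comm, smul_mul_assoc, hb]
  intro a ha b hb
  change a ∈ Submodule.span k (Set.range e) at ha
  induction ha using Submodule.span_induction with
  | mem a ha =>
    obtain ⟨i, rfl⟩ := ha
    exact h i b hb
  | zero => simp
  | add a c _ _ ha hc => rw [mul_add, add_mul, ha, hc]
  | smul r a _ ha => rw [mul_smul_comm, smul_mul_assoc, ha]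

/-- A functional which is `1` at a given nonzero idempotent of an orthogonal family and `0` at the
others. -/
theorem exists_dual_idempotent {ι : Type*} [DecidableEq ι] {e : ι → H}
    (hmul : ∀ i j, e i * e j = if i = j then e i else 0) {i : ι}
    (hi : e i ≠ 0) : ∃ f : Module.Dual k H, ∀ j, f (e j) = if i = j then 1 else 0 := by
  obtain ⟨g, hg⟩ : ∃ g : Module.Dual k H, g (e i) ≠ 0 := by
    by_contra! hg
    exact hi ((Module.forall_dual_apply_eq_zero_iff k (e i)).1 hg)
  -- Multiplication by `e i` kills the other idempotents. The family may contain zeros, so it need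
  -- not be a basis of its span.
  refine ⟨(g (e i))⁻¹ • g ∘ₗ LinearMap.mulLeft k (e i), fun j => ?_⟩
  simp only [LinearMap.smul_apply, LinearMap.comp_apply, LinearMap.mulLeft_apply, hmul]
  split_ifs <;> simp [hg]

end

variable [HopfAlgebra k H] {ι : Type*} [Fintype ι] [DecidableEq ι] {x : Matrix ι ι H}

theorem exists_ne_zero_of_sum_eq_one (k : Type*) [Field k] {H : Type*} [Ring H] [HopfAlgebra k H]
    {ι : Type*} [Fintype ι] {e : ι → H} (he : ∑ i, e i = 1) : ∃ i, e i ≠ 0 := by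
  have := nontrivial_of_hopfAlgebra k H
  by_contra! h
  simp [h] at he

/-- Column `c` spans a left coideal, as `Δ(x a c) = ∑ₗ x a l ⊗ x l c`. A functional with `f (x l c)
= δⱼₗ` extracts `x i j` from `Δ(x i c)`; it exists once `x j c ≠ 0`, and row `j`, having sum `1`,
provides such a `c`. -/
theorem IsMagicCorep.exists_leftCoefficients (hx : IsMagicCorep (k := k) x) (i j : ι) :
    ∃ L : Subalgebra k H, IsLeftCoideal (Subalgebra.toSubmodule L) ∧
      (∀ a ∈ L, ∀ b ∈ L, a * b = b * a) ∧ x i j ∈ leftCoefficients (Subalgebra.toSubmodule L) := by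
  obtain ⟨c, hc⟩ := exists_ne_zero_of_sum_eq_one k (hx.row_sum j)
  have hmul : ∀ a b, x a c * x b c = if a = b then x a c else 0 := fun a b => hx.col_mul a c b
  obtain ⟨f, hf⟩ := exists_dual_idempotent (k := k) (e := fun a => x a c) hmul hc
  let L := idempotentSpan (k := k) (fun a => x a c) hmul (hx.col_sum c)
  have hL : ∀ a, x a c ∈ Subalgebra.toSubmodule L := fun a => Submodule.subset_span ⟨a, rfl⟩
  let t : ι → H ⊗[k] Subalgebra.toSubmodule L :=
    fun a => ∑ l, x a l ⊗ₜ ⟨x l c, hL l⟩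
  have ht : ∀ a, (Subalgebra.toSubmodule L).subtype.lTensor H (t a) = comul (R := k) (x a c) :=
    fun a => by simp [t, hx.comul_eq]
  refine ⟨L, ?_, mul_comm_of_mem_idempotentSpan, x i c, hL i, t i,
    ht i, f ∘ₗ (Subalgebra.toSubmodule L).subtype, ?_⟩
  · have hle : Submodule.span k (Set.range fun a => x a c) ≤
        (LinearMap.range ((Subalgebra.toSubmodule L).subtype.lTensor H)).comap (comul (R := k)) := by
      rw [Submodule.span_le]
      rintro _ ⟨a, rfl⟩
      exact ⟨t a, ht a⟩
    exact fun a ha => hle ha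
  · simp [t, hf]

/-- The same with row `c`, where `x c i ≠ 0`: the entry `x i j` is read off from `Δ(x c j)`. -/
theorem IsMagicCorep.exists_rightCoefficients (hx : IsMagicCorep (k := k) x) (i j : ι) :
    ∃ L : Subalgebra k H, IsRightCoideal (Subalgebra.toSubmodule L) ∧
      (∀ a ∈ L, ∀ b ∈ L, a * b = b * a) ∧
        x i j ∈ rightCoefficients (Subalgebra.toSubmodule L) := by
  obtain ⟨c, hc⟩ := exists_ne_zero_of_sum_eq_one k (hx.col_sum i)
  have hmul : ∀ a b, x c a * x c b = if a = b then x c a else 0 := fun a b => hx.row_mul c a b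
  obtain ⟨f, hf⟩ := exists_dual_idempotent (k := k) (e := fun a => x c a) hmul hc
  let L := idempotentSpan (k := k) (fun a => x c a) hmul (hx.row_sum c)
  have hL : ∀ a, x c a ∈ Subalgebra.toSubmodule L := fun a => Submodule.subset_span ⟨a, rfl⟩
  let t : ι → Subalgebra.toSubmodule L ⊗[k] H :=
    fun a => ∑ l, ⟨x c l, hL l⟩ ⊗ₜ x l a
  have ht : ∀ a, (Subalgebra.toSubmodule L).subtype.rTensor H (t a) = comul (R := k) (x c a) :=
    fun a => by simp [t, hx.comul_eq]
  refine ⟨L, ?_, mul_comm_of_mem_idempotentSpan, x c j, hL j, t j,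
    ht j, f ∘ₗ (Subalgebra.toSubmodule L).subtype, ?_⟩
  · have hle : Submodule.span k (Set.range fun a => x c a) ≤
        (LinearMap.range ((Subalgebra.toSubmodule L).subtype.rTensor H)).comap (comul (R := k)) := by
      rw [Submodule.span_le]
      rintro _ ⟨a, rfl⟩
      exact ⟨t a, ht a⟩
    exact fun a ha => hle ha
  · simp [t, hf]

theorem eq_top_of_map_u_mem {n : ℕ} {f : As k n →ₐc[k] H} (hf : Function.Surjective f)
    {A : Subalgebra k H} (hA : ∀ i j, f (u i j) ∈ A) : A = ⊤ := by
  refine eq_top_iff.2 fun a _ => ?_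
  obtain ⟨b, rfl⟩ := hf a
  exact map_mem_of_map_u_mem f A hA b

theorem IsQuantumPermutationAlgebra.isGeneratedByLeft (h : IsQuantumPermutationAlgebra k H) :
    IsGeneratedByLeft k H := by
  obtain ⟨n, -, f, hf⟩ := h
  exact eq_top_of_map_u_mem hf fun i j =>
    Algebra.subset_adjoin ((isMagicCorep_map_u f).exists_leftCoefficients i j)

theorem IsQuantumPermutationAlgebra.isGeneratedByRight (h : IsQuantumPermutationAlgebra k H) :
    IsGeneratedByRight k H := by
  obtain ⟨n, -, f, hf⟩ := h
  exact eq_top_of_map_u_mem hf fun i j =>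
    Algebra.subset_adjoin ((isMagicCorep_map_u f).exists_rightCoefficients i j)

end Columns

end QuantumPermutation

theorem theorem2p3 {k : Type u} [Field k] [IsAlgClosed k] [CharZero k]
    {H : Type v} [Ring H] [HopfAlgebra k H] [Module.Finite k H]
    (hH : QuantumPermutation.IsCosemisimple k H) :
    (QuantumPermutation.IsQuantumPermutationAlgebra k H ↔
      QuantumPermutation.IsGeneratedByLeft k H) ∧
    (QuantumPermutation.IsQuantumPermutationAlgebra k H ↔
      QuantumPermutation.IsGeneratedByRight k H) :=
  ⟨⟨QuantumPermutation.IsQuantumPermutationAlgebra.isGeneratedByLeft,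
      QuantumPermutation.isQuantumPermutationAlgebra_of_isGeneratedByLeft hH⟩,
    ⟨QuantumPermutation.IsQuantumPermutationAlgebra.isGeneratedByRight,
      QuantumPermutation.isQuantumPermutationAlgebra_of_isGeneratedByRight hH⟩⟩
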